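/- **Theorem 5.1.** Let $\mathbb F_q$ be a finite field with $q$ elements, $F=\mathbb F_q(\!(t^{-1})\!)$ with valuation ring $\mathcal O=\mathbb F_q[\![t^{-1}]\!]$ and uniformizer $\pi=t^{-1}$. Let $G=PGL(4,F)$, let $W$ be the image of $GL(4,\mathcal O)$ in $G$, and let $\Gamma=PGL(4,\mathbb F_q[t])\subset G$. The vertices of the building $\mathcal B_4$ of $G$ are the cosets $gW$, where $gW$ stands for the homothety class of the lattice $g\mathcal O^4$; two vertices are adjacent if they are the classes of lattices $L,L'$ with $\pi L\subsetneq L'\subsetneq L$; the color of a vertex is $\tau(gW)=\deg\det g \bmod 4$ (with $\deg=-\mathrm{ord}_\pi$). On the quotient $\Gamma\backslash\mathcal B_4$ take the weights $w(v)=1/|\Gamma_v|$ on vertices and $w(e)=1/|\Gamma_e|$ on edges, and for $i=1,2,3$ and any function $f$ on the vertices of $\Gamma\backslash\mathcal B_4$ put $$A_{w,i}f(u)=\sum_{e=(u,v),\ \tau(v)=\tau(u)+i}\frac{w(e)}{w(u)}\,f(v),$$ the sum being over the edges $e$ of $\Gamma\backslash\mathcal B_4$ starting at $u$. For integers $\ell\ge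 m\ge n\ge 0$ let $v_{\ell,m,n}$ be the vertex of the quotient given by $\mathrm{diag}(t^\ell,t^m,t^n,1)$, so that $\tau(v_{\ell,m,n})=\ell+m+n \bmod 4$. Let $\mathbf z=(z_1,z_2,z_3,z_4)\in\mathbb C^4$ have pairwise distinct entries with $z_1z_2z_3z_4=1$, and put $$\lambda_1=q\sqrt q\,\sigma_1(\mathbf z),\qquad \lambda_2=q^2\sigma_2(\mathbf z),\qquad \lambda_3=q\sqrt q\,\sigma_3(\mathbf z),$$ where $\sigma_k$ is the $k$-th elementary symmetric polynomial. For $\{i,j,k,l\}=\{1,2,3,4\}$ put $$C_{ijk}=\frac{(z_i-qz_k)(z_i-qz_j)(z_i-qz_l)(z_j-qz_k)(z_j-qz_l)(z_k-qz_l)}{D\,(z_i-z_k)(z_i-z_j)(z_i-z_l)(z_j-z_k)(z_j-z_l)(z_k-z_l)},\qquad D=(q+1)(q^2+q+1)(q^3+q^2+q+1).$$ Then there is a function $f_{\mathbf z}$ on the vertices of $\Gamma\backslash\mathcal B_4$ with $A_{w,i}f_{\mathbf z}=\lambda_if_{\mathbf z}$ for $i=1,2,3$ and $f_{\mathbf z}(v_{0,0,0})=1$,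 it satisfies $$f_{\mathbf z}(v_{\ell,m,n})=\sum_{\tau\in S_4}C_{\tau(1)\tau(2)\tau(3)}\,\sqrt q^{\,3\ell+m-n}\,z_{\tau(1)}^{\ell}z_{\tau(2)}^{m}z_{\tau(3)}^{n}\qquad(\ell\ge m\ge n\ge 0),$$ and every function $f$ on the vertices of $\Gamma\backslash\mathcal B_4$ with $A_{w,i}f=\lambda_if$ for $i=1,2,3$ equals $f(v_{0,0,0})\,f_{\mathbf z}$. -/

import Mathlib

open scoped LaurentSeries PowerSeries MatrixGroups Pointwise

noncomputable section

namespace BuildingPGL4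

/-! Throughout, `K` is the finite field `𝔽_q`. The local field `F = 𝔽_q((t⁻¹))` is `K⸨X⸩` with the
uniformizer `X` playing the role of `t⁻¹`, and its valuation ring `𝒪 = 𝔽_q[[t⁻¹]]` is `K⟦X⟧`. -/

/-- The element `t = X⁻¹` of `F = 𝔽_q((t⁻¹))`. -/
def tElt (K : Type*) [Field K] : K⸨X⸩ := HahnSeries.single (-1 : ℤ) 1

/-- The embedding `𝔽_q[t] → 𝔽_q((t⁻¹))`, sending the variable to `t`. -/
def polyEmb (K : Type*) [Field K] : Polynomial K →+* K⸨X⸩ :=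
  Polynomial.eval₂RingHom HahnSeries.C (tElt K)

/-- `G = PGL(4, F)`. -/
abbrev G (K : Type*) [Field K] : Type _ := PGL(4, K⸨X⸩)

/-- `W`, the image of `GL(4, 𝒪)` in `PGL(4, F)`. -/
def W (K : Type*) [Field K] : Subgroup (G K) :=
  (Matrix.ProjGenLinGroup.map (n := Fin 4) (algebraMap K⟦X⟧ K⸨X⸩)).range

/-- `Γ = PGL(4, 𝔽_q[t])`, as a subgroup of `PGL(4, F)`. -/
def Gam (K : Type*) [Field K] : Subgroup (G K) :=
  (Matrix.ProjGenLinGroup.map (n := Fin 4) (polyEmb K)).range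

/-- The vertices of the building, `G / W`. The coset `gW` stands for the homothety class of the
lattice `L_g = g 𝒪⁴` (see `lattice` below). `Γ` acts by left multiplication. -/
abbrev Vertex (K : Type*) [Field K] : Type _ := G K ⧸ W K

/-- The vertex `[L_g]` attached to an invertible matrix `g`. -/
def vertexOf {K : Type*} [Field K] (g : GL (Fin 4) K⸨X⸩) : Vertex K :=
  QuotientGroup.mk (Matrix.ProjGenLinGroup.mk g)

/-- The lattice `L_g = g 𝒪⁴`: the `𝒪`-span in `F⁴` of the columns of `g`. -/
def lattice {K : Type*} [Field K] (g : GL (Fin 4) K⸨X⸩) : Submodule K⟦X⟧ (Fin 4 → K⸨X⸩) :=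
  Submodule.span K⟦X⟧ (Set.range (g : Matrix (Fin 4) (Fin 4) K⸨X⸩).col)

/-- Adjacency in the building: some lattices `L`, `L'` in the two homothety classes satisfy
`π L ⊊ L' ⊊ L`, where `π = t⁻¹`. -/
def Adj {K : Type*} [Field K] (x y : Vertex K) : Prop :=
  ∃ g h : GL (Fin 4) K⸨X⸩, vertexOf g = x ∧ vertexOf h = y ∧
    (PowerSeries.X : K⟦X⟧) • lattice g < lattice h ∧ lattice h < lattice g

/-- `g ↦ deg (det g) mod 4` on `GL(4, F)`, where `deg = - ord_π` is the degree in `t`. -/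
def degDet (K : Type*) [Field K] : GL (Fin 4) K⸨X⸩ →* Multiplicative (ZMod 4) where
  toFun g := Multiplicative.ofAdd
    (((-(HahnSeries.order (Matrix.det (g : Matrix (Fin 4) (Fin 4) K⸨X⸩))) : ℤ)) : ZMod 4)
  map_one' := by simp
  map_mul' g h := by
    have hg : Matrix.det (g : Matrix (Fin 4) (Fin 4) K⸨X⸩) ≠ 0 :=
      (Matrix.GeneralLinearGroup.det g).ne_zero
    have hh : Matrix.det (h : Matrix (Fin 4) (Fin 4) K⸨X⸩) ≠ 0 :=
      (Matrix.GeneralLinearGroup.det h).ne_zero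
    rw [← ofAdd_add, Units.val_mul, Matrix.det_mul, HahnSeries.order_mul hg hh]
    push_cast
    rw [neg_add]

/-- The induced homomorphism on `PGL(4, F)`. -/
def degDetPGL (K : Type*) [Field K] : G K →* Multiplicative (ZMod 4) :=
  Matrix.ProjGenLinGroup.lift (degDet K) (by
    ext u
    have h4 : (4 : ZMod 4) = 0 := by decide
    simp [degDet, HahnSeries.order_pow, h4])

theorem degDetPGL_W {K : Type*} [Field K] (w : G K) (hw : w ∈ W K) : degDetPGL K w = 1 := by
  obtain ⟨v, rfl⟩ := hw
  obtain ⟨a, rfl⟩ := Matrix.ProjGenLinGroup.mk_surjective v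
  have ha : IsUnit (Matrix.det (a : Matrix (Fin 4) (Fin 4) K⟦X⟧)) :=
    (Matrix.GeneralLinearGroup.det a).isUnit
  have key : ∀ p : K⟦X⟧, IsUnit p → HahnSeries.order (algebraMap K⟦X⟧ K⸨X⸩ p) = 0 := by
    rintro p ⟨u, rfl⟩
    have hnn : ∀ r : K⟦X⟧, 0 ≤ HahnSeries.order (algebraMap K⟦X⟧ K⸨X⸩ r) := by
      intro r
      by_cases hr : algebraMap K⟦X⟧ K⸨X⸩ r = 0
      · rw [hr, HahnSeries.order_zero]
      · by_contra! hlt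
        refine HahnSeries.coeff_order_eq_zero.not.mpr hr ?_
        rw [LaurentSeries.coe_algebraMap] at hlt ⊢
        rw [HahnSeries.ofPowerSeries_apply]
        refine HahnSeries.embDomain_of_notMem_range ?_
        rintro ⟨n, hn⟩
        have hn' : (n : ℤ) = HahnSeries.order (HahnSeries.ofPowerSeries ℤ K r) := hn
        omega
    have hmul : algebraMap K⟦X⟧ K⸨X⸩ u * algebraMap K⟦X⟧ K⸨X⸩ (u⁻¹ : K⟦X⟧ˣ) = 1 := by
      rw [← map_mul, Units.mul_inv, map_one]
    have hsum := HahnSeries.order_mul (left_ne_zero_of_mul_eq_one hmul)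
      (right_ne_zero_of_mul_eq_one hmul)
    rw [hmul, HahnSeries.order_one] at hsum
    have h1 := hnn u
    have h2 := hnn (u⁻¹ : K⟦X⟧ˣ)
    omega
  have hdet : Matrix.det ((Matrix.GeneralLinearGroup.map (algebraMap K⟦X⟧ K⸨X⸩) a :
      GL (Fin 4) K⸨X⸩) : Matrix (Fin 4) (Fin 4) K⸨X⸩) =
      algebraMap K⟦X⟧ K⸨X⸩ (Matrix.det (a : Matrix (Fin 4) (Fin 4) K⟦X⟧)) :=
    (RingHom.map_det _ _).symm
  rw [Matrix.ProjGenLinGroup.map_mk, degDetPGL, Matrix.ProjGenLinGroup.lift_mk]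
  change Multiplicative.ofAdd (((-(HahnSeries.order _) : ℤ)) : ZMod 4) = 1
  rw [hdet, key _ ha]
  simp

/-- The colour `τ : G / W → ℤ/4`, `τ(gW) = deg (det g) mod 4`. The sign is the one for which
`τ(v_{ℓ,m,n}) = ℓ + m + n` (see `v` below). -/
def color {K : Type*} [Field K] (x : Vertex K) : ZMod 4 :=
  Quotient.liftOn' x (fun g => Multiplicative.toAdd (degDetPGL K g)) (by
    intro g h hgh
    have h1 := degDetPGL_W _ (QuotientGroup.leftRel_apply.mp hgh)
    rw [map_mul, map_inv, inv_mul_eq_one] at h1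
    exact congrArg Multiplicative.toAdd h1)

/-- The vertices of the quotient complex: `Γ`-orbits of vertices. -/
abbrev QVertex (K : Type*) [Field K] : Type _ := MulAction.orbitRel.Quotient (Gam K) (Vertex K)

/-- `Γ`-orbits of ordered pairs of vertices; the oriented edges of the quotient complex are the
orbits of the adjacent pairs. -/
abbrev QPair (K : Type*) [Field K] : Type _ :=
  MulAction.orbitRel.Quotient (Gam K) (Vertex K × Vertex K)

/-- The orbit of a vertex. -/
def toQ {K : Type*} [Field K] (x : Vertex K) : QVertex K := Quotient.mk'' x

/-- The orbit of an ordered pair of vertices. -/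
def toQPair {K : Type*} [Field K] (x y : Vertex K) : QPair K := Quotient.mk'' (x, y)

/-- The end point of an oriented edge of the quotient. -/
def target {K : Type*} [Field K] (e : QPair K) : QVertex K :=
  Quotient.liftOn' e (fun p => toQ p.2) (by
    rintro p p' ⟨γ, rfl⟩
    exact Quotient.sound' ⟨γ, rfl⟩)

/-- The weight of an orbit: the inverse of the cardinality of a stabilizer. On `QVertex` this is
`w(v) = 1 / |Γ_v|`; on `QPair` it is `w(e) = 1 / |Γ_e|`, with `Γ_e = Γ_x ∩ Γ_y` for `e = (x, y)`. -/
def weight {H Y : Type*} [Group H] [MulAction H Y] (o : MulAction.orbitRel.Quotient H Y) : ℝ :=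
  Quotient.liftOn' o (fun y => ((Nat.card (MulAction.stabilizer H y) : ℝ))⁻¹) (by
    intro y y' h
    have := Nat.card_congr (MulAction.stabilizerEquivStabilizerOfOrbitRel h).toEquiv
    simp only [this])

/-- The oriented edges of the quotient that start at `u` and raise the colour by `i`. -/
def outEdges {K : Type*} [Field K] (i : ZMod 4) (u : QVertex K) : Set (QPair K) :=
  {e | ∃ x y : Vertex K, Adj x y ∧ color y = color x + i ∧ toQ x = u ∧ toQPair x y = e}

/-- The weighted adjacency operator `A_{w,i}` on functions on the vertices of the quotient:
`A_{w,i} f (u) = ∑_{e = (u, v), τ(v) = τ(u) + i} (w(e) / w(u)) f(v)`. -/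
def weightedAdj {K : Type*} [Field K] (i : ZMod 4) (f : QVertex K → ℂ) : QVertex K → ℂ :=
  fun u => ∑ᶠ e ∈ outEdges i u, ((weight e / weight u : ℝ) : ℂ) * f (target e)

/-- `f` satisfies `A_{w,i} f = λ_i f` for `i = 1, 2, 3`. -/
def SatisfiesEigenEqs {K : Type*} [Field K] (lam₁ lam₂ lam₃ : ℂ) (f : QVertex K → ℂ) : Prop :=
  weightedAdj 1 f = lam₁ • f ∧ weightedAdj 2 f = lam₂ • f ∧ weightedAdj 3 f = lam₃ • f

/-- The matrix `diag(t^ℓ, t^m, t^n, 1)`. -/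
def diagMat (K : Type*) [Field K] (l m n : ℕ) : GL (Fin 4) K⸨X⸩ :=
  Matrix.GeneralLinearGroup.mkOfDetNeZero
    (Matrix.diagonal ![tElt K ^ l, tElt K ^ m, tElt K ^ n, 1]) (by
      have ht : tElt K ≠ 0 := HahnSeries.single_ne_zero one_ne_zero
      rw [Matrix.det_diagonal, Fin.prod_univ_four]
      simp [ht])

/-- The vertex `v_{ℓ,m,n}` of the quotient, the class of `diag(t^ℓ, t^m, t^n, 1)`. -/
def v (K : Type*) [Field K] (l m n : ℕ) : QVertex K := toQ (vertexOf (diagMat K l m n))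

/-- The elementary symmetric polynomial `σ_k(z_1, z_2, z_3, z_4)`. -/
def sigma (k : ℕ) (z : Fin 4 → ℂ) : ℂ := (Finset.univ.val.map z).esymm k

/-- `D = (q+1)(q²+q+1)(q³+q²+q+1)`. -/
def constD (q : ℂ) : ℂ := (q + 1) * (q ^ 2 + q + 1) * (q ^ 3 + q ^ 2 + q + 1)

/-- The constant `C_{ijk}`, where `{i, j, k, l}` is the whole index set. -/
def constC (q : ℂ) (z : Fin 4 → ℂ) (i j k l : Fin 4) : ℂ :=
  ((z i - q * z k) * (z i - q * z j) * (z i - q * z l) * (z j - q * z k) * (z j - q * z l) *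
      (z k - q * z l)) /
    (constD q * (z i - z k) * (z i - z j) * (z i - z l) * (z j - z k) * (z j - z l) *
      (z k - z l))

end BuildingPGL4

end

noncomputable section

namespace BuildingPGL4

/-! ### Schubert cells: every subspace of `Kⁿ` has a unique reduced basis -/

/-! The quotient `Γ \ G / W` is the set of antitone weights `μ : Fin 4 → ℤ` modulo constants, `μ`
standing for the orbit of `t^μ`. Everything reduces to a recursion on these weights, which a
Hall–Littlewood sum solves explicitly.

The recursion. Neighbours of `[L]` that raise the colour by `i` correspond to subspaces of `L/πL` of
dimension `i`. Each subspace lies in exactly one Schubert cell, so a neighbour of `[g]` is `g u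
t^(ind S)` for a unique pivot set `S` of size `i` and a unique constant unipotent `u` of that cell
(`adj_iff_cell`, `cellGL_injective`). If `g = t^μ` with `μ` antitone, then `t^μ u t^(-μ)` is
polynomial, hence in `Γ`, and the whole cell falls in the orbit of `t^(μ + ind S)` (`toQ_cell`). By
orbit–stabilizer `w(e)/w(u)` counts the neighbours lying over `e`. So `A_{w,i} f (μ)` is the sum
over `|S| = i` of `q^(dim of cell S) f(μ + ind S)` (`weightedAdj_tDiag`), where `f` is read as a
function of all weights.

Existence. The sum `hallSum` makes sense for every weight and satisfies this recursion formally,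
because `2 dim + rho (ind S) = i (4 - i)` does not depend on `S` (`hallSum_pieri`). The recursion
also evaluates at weights `μ + ind S` that are not antitone. Their entries are out of order by one
only, and `hallSum` is unchanged when such entries are swapped (`hallSum_swapInv`), so it agrees
with a function on orbits there too. The value at `0` is `1` by Macdonald's identity
(`hallSum_zero`).

Uniqueness. The recursion is triangular for `rho`: at `ν` its top term is `ν + ind (fund i)`, with a
positive integer coefficient, and every weight is reached in this way from `0` (`eq_zero_of_eigen`).
-/

/-- The free positions of the Schubert cell with pivot set `S`. -/
abbrev CellIndex {n : ℕ} (S : Finset (Fin n)) : Type :=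
  {p : Fin n × Fin n // p.1 < p.2 ∧ p.1 ∉ S ∧ p.2 ∈ S}

/-- The nilpotent matrix with the given entries at the free positions. -/
def cellNil {n : ℕ} {R : Type*} [Zero R] (S : Finset (Fin n)) (c : CellIndex S → R) :
    Matrix (Fin n) (Fin n) R :=
  Matrix.of fun i j => if h : i < j ∧ i ∉ S ∧ j ∈ S then c ⟨(i, j), h⟩ else 0

theorem cellNil_eq_zero_of_mem {n : ℕ} {R : Type*} [Zero R] {S : Finset (Fin n)}
    (c : CellIndex S → R) {i : Fin n} (j : Fin n) (hi : i ∈ S) : cellNil S c i j = 0 := by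
  simp [cellNil, hi]

theorem cellNil_eq_zero_of_notMem {n : ℕ} {R : Type*} [Zero R] {S : Finset (Fin n)}
    (c : CellIndex S → R) (i : Fin n) {j : Fin n} (hj : j ∉ S) : cellNil S c i j = 0 := by
  simp [cellNil, hj]

theorem cellNil_eq_zero_of_le {n : ℕ} {R : Type*} [Zero R] {S : Finset (Fin n)}
    (c : CellIndex S → R) {i j : Fin n} (hij : j ≤ i) : cellNil S c i j = 0 := by
  simp [cellNil, hij.not_gt]

/-- The unipotent matrix with the given entries at the free positions. -/
def unip {n : ℕ} {R : Type*} [Ring R] (S : Finset (Fin n)) (c : CellIndex S → R) :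
    Matrix (Fin n) (Fin n) R :=
  1 + cellNil S c

theorem cellNil_add {n : ℕ} {R : Type*} [Ring R] (S : Finset (Fin n)) (c d : CellIndex S → R) :
    cellNil S (c + d) = cellNil S c + cellNil S d := by
  ext i j
  simp only [cellNil, Matrix.of_apply, Matrix.add_apply]
  split_ifs <;> simp

/-- The nonzero rows have index off `S` and the nonzero columns index in `S`, so the inner index has
nowhere to live. Hence `unip S` turns addition into multiplication. -/
theorem cellNil_mul {n : ℕ} {R : Type*} [Ring R] (S : Finset (Fin n)) (c d : CellIndex S → R) :
    cellNil S c * cellNil S d = 0 := by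
  ext i j
  rw [Matrix.mul_apply]
  refine Finset.sum_eq_zero fun k _ => ?_
  by_cases hk : k ∈ S
  · rw [cellNil_eq_zero_of_mem d j hk, mul_zero]
  · rw [cellNil_eq_zero_of_notMem c i hk, zero_mul]

theorem unip_mul {n : ℕ} {R : Type*} [Ring R] (S : Finset (Fin n)) (c d : CellIndex S → R) :
    unip S c * unip S d = unip S (c + d) := by
  simp only [unip, mul_add, add_mul, cellNil_mul, cellNil_add, mul_one, one_mul]
  abel

theorem unip_zero {n : ℕ} {R : Type*} [Ring R] (S : Finset (Fin n)) :
    unip S (0 : CellIndex S → R) = 1 := by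
  ext i j
  simp [unip, cellNil]

theorem unip_map {n : ℕ} {R R' : Type*} [Ring R] [Ring R'] (f : R →+* R') (S : Finset (Fin n))
    (c : CellIndex S → R) : (unip S c).map f = unip S (fun p => f (c p)) := by
  ext i j
  simp only [unip, cellNil, Matrix.map_apply, Matrix.add_apply, Matrix.of_apply, map_add,
    Matrix.one_apply]
  split_ifs <;> simp

/-- `unip S c` as an invertible matrix. -/
def unipGL {n : ℕ} {R : Type*} [CommRing R] (S : Finset (Fin n)) (c : CellIndex S → R) :
    GL (Fin n) R where
  val := unip S c
  inv := unip S (-c)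
  val_inv := by rw [unip_mul, add_neg_cancel, unip_zero]
  inv_val := by rw [unip_mul, neg_add_cancel, unip_zero]

/-- The subspace spanned by the columns of `unip S c` with index in `S`. -/
def InCell {n : ℕ} {K : Type*} [Field K] (S : Finset (Fin n)) (c : CellIndex S → K)
    (x : Fin n → K) : Prop :=
  ∀ i ∉ S, x i = ∑ j, cellNil S c i j * x j

theorem inCell_iff {n : ℕ} {K : Type*} [Field K] (S : Finset (Fin n)) (c : CellIndex S → K)
    (x : Fin n → K) : InCell S c x ↔ ∀ i ∉ S, (unip S (-c)).mulVec x i = 0 := by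
  have hneg : cellNil S (-c) = - cellNil S c := by
    ext i j
    simp only [cellNil, Matrix.of_apply, Matrix.neg_apply]
    split_ifs <;> simp
  refine forall₂_congr fun i _ => ?_
  rw [unip, hneg, Matrix.add_mulVec, Matrix.one_mulVec, Matrix.neg_mulVec, Pi.add_apply,
    Pi.neg_apply, ← sub_eq_add_neg, sub_eq_zero]
  rfl

/-- Reduced echelon form, read from the end: the pivots are the positions at which some vector of
`U` has its last nonzero entry. The free entries are the remaining coordinates of the basis
normalised to be `δ` on the pivots. -/
theorem exists_inCell {n : ℕ} {K : Type*} [Field K] (U : Submodule K (Fin n → K)) :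
    ∃ (S : Finset (Fin n)) (c : CellIndex S → K), ∀ x, x ∈ U ↔ InCell S c x := by
  classical
  set S : Finset (Fin n) :=
    Finset.univ.filter fun j => ∃ x ∈ U, x j = 1 ∧ ∀ k, j < k → x k = 0 with hS
  have memS : ∀ j, j ∈ S ↔ ∃ x ∈ U, x j = 1 ∧ ∀ k, j < k → x k = 0 := by simp [hS]
  -- The last nonzero position of a nonzero vector of `U` would be a pivot.
  have hzero : ∀ x ∈ U, (∀ j ∈ S, x j = 0) → x = 0 := by
    intro x hx hxS
    by_contra hne
    have hne' : (Finset.univ.filter fun k => x k ≠ 0).Nonempty := by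
      obtain ⟨k, hk⟩ := Function.ne_iff.mp hne
      exact ⟨k, by simpa using hk⟩
    obtain ⟨k, hk, hmax⟩ := Finset.exists_max_image _ id hne'
    have hk0 : x k ≠ 0 := by simpa using hk
    refine hk0 (hxS k ((memS k).2 ⟨(x k)⁻¹ • x, U.smul_mem _ hx, by simp [hk0], fun l hl => ?_⟩))
    have : x l = 0 := by
      by_contra h
      exact absurd (hmax l (by simpa using h)) (not_le.2 hl)
    simp [this]
  -- Strong induction: the earlier basis vectors clear the entries at the smaller pivots and do not
  -- touch position `j` or beyond.
  have hbasis : ∀ j : Fin n, j ∈ S → ∃ x ∈ U, x j = 1 ∧ (∀ k, j < k → x k = 0) ∧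
      ∀ k ∈ S, k < j → x k = 0 := by
    intro j
    induction j using WellFoundedLT.induction with
    | ind j ih =>
      intro hj
      obtain ⟨y, hyU, hy1, hy0⟩ := (memS j).1 hj
      choose! b hbU hb1 hb0 hbS using ih
      refine ⟨y - ∑ k ∈ S.filter (· < j), y k • b k, U.sub_mem hyU (U.sum_mem fun k hk => ?_),
        ?_, ?_, ?_⟩
      · have hk := Finset.mem_filter.1 hk
        exact U.smul_mem _ (hbU k hk.2 hk.1)
      · rw [Pi.sub_apply, Finset.sum_apply, Finset.sum_eq_zero, hy1, sub_zero]
        intro k hk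
        have hk := Finset.mem_filter.1 hk
        simp [hb0 k hk.2 hk.1 j hk.2]
      · intro l hl
        rw [Pi.sub_apply, Finset.sum_apply, Finset.sum_eq_zero, hy0 l hl, sub_zero]
        intro k hk
        have hk := Finset.mem_filter.1 hk
        simp [hb0 k hk.2 hk.1 l (hk.2.trans hl)]
      · intro l hl hlj
        rw [Pi.sub_apply, Finset.sum_apply, Finset.sum_eq_single l]
        · simp [hb1 l hlj hl]
        · intro k hk hkl
          have hk := Finset.mem_filter.1 hk
          rcases lt_or_gt_of_ne hkl with h | h
          · simp [hb0 k hk.2 hk.1 l h]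
          · simp [hbS k hk.2 hk.1 l hl h]
        · intro h
          exact absurd (Finset.mem_filter.2 ⟨hl, hlj⟩) h
  choose! b hbU hb1 hb0 hbS using hbasis
  have hδ : ∀ j ∈ S, ∀ k ∈ S, b j k = if j = k then 1 else 0 := by
    intro j hj k hk
    split_ifs with h
    · rw [← h, hb1 j hj]
    · rcases lt_or_gt_of_ne h with h | h
      · exact hb0 j hj k h
      · exact hbS j hj k hk h
  have hN : ∀ i ∉ S, ∀ j ∈ S, cellNil S (fun p => b p.1.2 p.1.1) i j = b j i := by
    intro i hi j hj
    rcases lt_trichotomy i j with h | h | h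
    · simp [cellNil, hi, hj, h]
    · exact absurd (h ▸ hj) hi
    · rw [hb0 j hj i h, cellNil_eq_zero_of_le _ h.le]
  have hsum : ∀ (i : Fin n) (x : Fin n → K), i ∉ S →
      ∑ j, cellNil S (fun p => b p.1.2 p.1.1) i j * x j = (∑ j ∈ S, x j • b j) i := by
    intro i x hi
    rw [Finset.sum_apply, ← Finset.sum_subset (Finset.subset_univ S)]
    · exact Finset.sum_congr rfl fun j hj => by
        rw [hN i hi j hj, Pi.smul_apply, smul_eq_mul, mul_comm]
    · intro j _ hj
      rw [cellNil_eq_zero_of_notMem _ i hj, zero_mul]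
  have hS' : ∀ (i : Fin n) (x : Fin n → K), i ∈ S → (∑ j ∈ S, x j • b j) i = x i := by
    intro i x hi
    rw [Finset.sum_apply, Finset.sum_eq_single i]
    · simp [hb1 i hi]
    · intro j hj hji
      simp [hδ j hj i hi, hji]
    · exact fun h => absurd hi h
  have hmem : ∀ x : Fin n → K, ∑ j ∈ S, x j • b j ∈ U := fun x =>
    U.sum_mem fun j hj => U.smul_mem _ (hbU j hj)
  refine ⟨S, fun p => b p.1.2 p.1.1, fun x => ⟨fun hx i hi => ?_, fun hx => ?_⟩⟩
  · have := hzero (x - ∑ j ∈ S, x j • b j) (U.sub_mem hx (hmem x)) fun j hj => by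
      rw [Pi.sub_apply, hS' j x hj, sub_self]
    rw [hsum i x hi]
    exact congrFun (sub_eq_zero.1 this) i
  · have : x = ∑ j ∈ S, x j • b j := by
      ext i
      by_cases hi : i ∈ S
      · rw [hS' i x hi]
      · rw [hx i hi, hsum i x hi]
    rw [this]
    exact hmem x

theorem inCell_col {n : ℕ} {K : Type*} [Field K] (S : Finset (Fin n)) (c : CellIndex S → K)
    {j : Fin n} (hj : j ∈ S) : InCell S c (fun i => unip S c i j) := by
  intro i hi
  rw [Finset.sum_eq_single j]
  · have hij : i ≠ j := fun h => hi (h ▸ hj)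
    simp [unip, hij, cellNil_eq_zero_of_mem c j hj]
  · intro k _ hk
    by_cases hkS : k ∈ S
    · simp [unip, hk, cellNil_eq_zero_of_mem c j hkS]
    · rw [cellNil_eq_zero_of_notMem c i hkS, zero_mul]
  · simp

/-- For `j ∈ S` outside `S'`, the equation at `j` expresses the entry `1` of the column `j` through
its entries beyond `j`, which are all zero. -/
theorem inCell_subset {n : ℕ} {K : Type*} [Field K] {S S' : Finset (Fin n)} {c : CellIndex S → K}
    {c' : CellIndex S' → K} (h : ∀ x, InCell S c x → InCell S' c' x) : S ⊆ S' := by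
  intro j hj
  by_contra hj'
  have h1 := h _ (inCell_col S c hj) j hj'
  rw [Finset.sum_eq_zero] at h1
  · simp [unip, cellNil_eq_zero_of_mem c j hj] at h1
  · intro k _
    rcases le_or_gt k j with hk | hk
    · rw [cellNil_eq_zero_of_le _ hk, zero_mul]
    · simp [unip, hk.ne', cellNil_eq_zero_of_le c hk.le]

theorem inCell_unique {n : ℕ} {K : Type*} [Field K] {S S' : Finset (Fin n)} {c : CellIndex S → K}
    {c' : CellIndex S' → K} (h : ∀ x, InCell S c x ↔ InCell S' c' x) :
    (⟨S, c⟩ : (S : Finset (Fin n)) × (CellIndex S → K)) = ⟨S', c'⟩ := by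
  obtain rfl : S = S' := Finset.Subset.antisymm (inCell_subset fun x => (h x).1)
    (inCell_subset fun x => (h x).2)
  congr 1
  ext ⟨⟨i, j⟩, hij, hi, hj⟩
  have h1 := (h _).1 (inCell_col S c hj) i hi
  rw [Finset.sum_eq_single j] at h1
  · simpa [unip, hij.ne, cellNil, hi, hj, hij] using h1
  · intro k _ hk
    by_cases hkS : k ∈ S
    · simp [unip, hk, cellNil_eq_zero_of_mem c j hkS]
    · rw [cellNil_eq_zero_of_notMem c' i hkS, zero_mul]
  · simp

/-! ### Weights and Hall–Littlewood sums -/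

/-- The pairing of a weight of `GL₄` with twice the half-sum of positive roots. -/
def rho (μ : Fin 4 → ℤ) : ℤ := 3 * μ 0 + μ 1 - μ 2 - 3 * μ 3

/-- The indicator weight of a set of indices. -/
def ind (S : Finset (Fin 4)) : Fin 4 → ℤ := fun i => if i ∈ S then 1 else 0

theorem rho_add (μ ν : Fin 4 → ℤ) : rho (μ + ν) = rho μ + rho ν := by
  simp only [rho, Pi.add_apply]
  ring

/-- `rho μ` is the sum of `μ i - μ j` over `i < j`. On `ind S` it counts the pairs with `i ∈ S`, `j
∉ S` minus those with `i ∉ S`, `j ∈ S`. The latter are the free positions of the cell, and both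
kinds together number `|S| (4 - |S|)`. -/
theorem rho_ind (S : Finset (Fin 4)) :
    2 * (Fintype.card (CellIndex S) : ℤ) + rho (ind S) = S.card * (4 - S.card) := by
  revert S
  decide

/-- Invariance of a function of weights under simple reflections that sort adjacent entries
differing by one. -/
def SwapInv {α : Type*} (φ : (Fin 4 → ℤ) → α) : Prop :=
  ∀ (μ : Fin 4 → ℤ) (k : Fin 3), μ k.succ = μ k.castSucc + 1 →
    φ (μ ∘ Equiv.swap k.castSucc k.succ) = φ μ

theorem rho_ind_swap (S : Finset (Fin 4)) (k : Fin 3) (h1 : k.castSucc ∉ S) (h2 : k.succ ∈ S) :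
    rho (ind S) < rho (ind (S.map (Equiv.swap k.castSucc k.succ).toEmbedding)) := by
  revert S k
  decide

theorem rho_ind_le (S : Finset (Fin 4)) : rho (ind S) ≤ 4 := by
  revert S
  decide

/-- Bubble sort. Adding `ind S` can break monotonicity only where `μ` has two equal neighbouring
entries, and then by one. Swapping them moves a single element of `S` one place to the left, which
raises `rho (ind S)`; this is bounded by `4`, so the process stops. The resulting `S'` serves all
`φ` at once. -/
theorem exists_antitone_of_swapInv {μ : Fin 4 → ℤ} (hμ : Antitone μ) (S : Finset (Fin 4)) :
    ∃ S' : Finset (Fin 4), S'.card = S.card ∧ Antitone (μ + ind S') ∧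
      ∀ {α : Type} (φ : (Fin 4 → ℤ) → α), SwapInv φ → φ (μ + ind S) = φ (μ + ind S') := by
  obtain ⟨N, hN⟩ : ∃ N : ℕ, 4 - rho (ind S) ≤ N :=
    ⟨(4 - rho (ind S)).toNat, Int.self_le_toNat _⟩
  induction N generalizing S with
  | zero =>
    by_cases h : Antitone (μ + ind S)
    · exact ⟨S, rfl, h, fun _ _ => rfl⟩
    · exfalso
      rw [Fin.antitone_iff_succ_le] at h hμ
      push Not at h
      obtain ⟨k, hk⟩ := h
      have hk' := hμ k
      have h12 : k.castSucc ∉ S ∧ k.succ ∈ S := by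
        simp only [Pi.add_apply, ind] at hk
        split_ifs at hk <;> first | exact ⟨by assumption, by assumption⟩ | omega
      have := rho_ind_swap S k h12.1 h12.2
      have := rho_ind_le (S.map (Equiv.swap k.castSucc k.succ).toEmbedding)
      omega
  | succ N ih =>
    by_cases h : Antitone (μ + ind S)
    · exact ⟨S, rfl, h, fun _ _ => rfl⟩
    · have hμ' := hμ
      rw [Fin.antitone_iff_succ_le] at h hμ'
      push Not at h
      obtain ⟨k, hk⟩ := h
      have hk' := hμ' k
      have h12 : (k.castSucc ∉ S ∧ k.succ ∈ S) ∧ μ k.succ = μ k.castSucc := by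
        simp only [Pi.add_apply, ind] at hk
        split_ifs at hk <;>
          first | exact ⟨⟨by assumption, by assumption⟩, by omega⟩ | omega
      have hlt := rho_ind_swap S k h12.1.1 h12.1.2
      obtain ⟨S', hc, ha, hφ⟩ := ih (S.map (Equiv.swap k.castSucc k.succ).toEmbedding)
        (by push_cast at hN; omega)
      refine ⟨S', by rw [hc, Finset.card_map], ha, fun φ hs => ?_⟩
      rw [← hφ φ hs, ← hs (μ + ind S) k (by simp [ind, h12])]
      congr 1
      ext i
      have hi : ind (S.map (Equiv.swap k.castSucc k.succ).toEmbedding) i =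
          ind S (Equiv.swap k.castSucc k.succ i) := by
        simp only [ind, Finset.mem_map_equiv, Equiv.symm_swap]
      rw [Function.comp_apply, Pi.add_apply, Pi.add_apply, hi]
      congr 1
      by_cases h1 : i = k.castSucc
      · rw [h1, Equiv.swap_apply_left, h12.2]
      · by_cases h2 : i = k.succ
        · rw [h2, Equiv.swap_apply_right, h12.2]
        · rw [Equiv.swap_apply_of_ne_of_ne h1 h2]

/-- The Hall–Littlewood sum attached to an arbitrary weight. -/
def hallSum (q sq : ℂ) (z : Fin 4 → ℂ) (μ : Fin 4 → ℤ) : ℂ :=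
  ∑ τ : Equiv.Perm (Fin 4), constC q z (τ 0) (τ 1) (τ 2) (τ 3) * sq ^ rho μ *
    ∏ i, z (τ i) ^ μ i

theorem sigma_comp_perm (k : ℕ) (z : Fin 4 → ℂ) (τ : Equiv.Perm (Fin 4)) :
    sigma k (z ∘ τ) = sigma k z := by
  unfold sigma
  congr 1
  rw [← Multiset.map_map]
  congr 1
  have := congrArg Finset.val (Finset.map_univ_equiv τ)
  rwa [Finset.map_val] at this

theorem sigma_eq_sum (k : ℕ) (z : Fin 4 → ℂ) :
    sigma k z = ∑ S ∈ Finset.powersetCard k Finset.univ, ∏ i ∈ S, z i :=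
  Finset.esymm_map_val _ _ _

/-- Expand `sigma r` over subsets inside each summand, using its symmetry under `τ`. By `rho_ind`
the powers of `q` and `sq` attached to `S` combine to `sq ^ (r (4 - r))`. No monotonicity of `μ`
enters. -/
theorem hallSum_pieri {q sq : ℂ} (hsq : sq ^ 2 = q) (h0 : sq ≠ 0) {z : Fin 4 → ℂ}
    (hz : ∀ i, z i ≠ 0) (r : ℕ) (μ : Fin 4 → ℤ) :
    ∑ S ∈ Finset.powersetCard r Finset.univ,
      q ^ Fintype.card (CellIndex S) * hallSum q sq z (μ + ind S) =
      sq ^ ((r : ℤ) * (4 - r)) * sigma r z * hallSum q sq z μ := by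
  have key : ∀ S ∈ Finset.powersetCard r (Finset.univ : Finset (Fin 4)),
      q ^ Fintype.card (CellIndex S) * hallSum q sq z (μ + ind S) =
        ∑ τ : Equiv.Perm (Fin 4), sq ^ ((r : ℤ) * (4 - r)) * (∏ i ∈ S, (z ∘ τ) i) *
          (constC q z (τ 0) (τ 1) (τ 2) (τ 3) * sq ^ rho μ * ∏ i, z (τ i) ^ μ i) := by
    intro S hS
    have hr := (Finset.mem_powersetCard.1 hS).2
    rw [hallSum, Finset.mul_sum]
    refine Finset.sum_congr rfl fun τ _ => ?_
    have h1 : sq ^ ((r : ℤ) * (4 - r)) = q ^ Fintype.card (CellIndex S) * sq ^ rho (ind S) := by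
      rw [← hr, ← rho_ind, zpow_add₀ h0, zpow_mul, ← hsq]
      norm_cast
    have h2 : ∏ i, z (τ i) ^ (μ + ind S) i = (∏ i ∈ S, (z ∘ τ) i) * ∏ i, z (τ i) ^ μ i := by
      simp only [Pi.add_apply, zpow_add₀ (hz _), Finset.prod_mul_distrib]
      rw [mul_comm]
      congr 1
      rw [← Finset.prod_subset (Finset.subset_univ S)]
      · exact Finset.prod_congr rfl fun i hi => by simp [ind, hi]
      · intro i _ hi
        simp [ind, hi]
    rw [h1, h2, rho_add, zpow_add₀ h0]
    ring
  rw [Finset.sum_congr rfl key, Finset.sum_comm, hallSum, Finset.mul_sum]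
  refine Finset.sum_congr rfl fun τ _ => ?_
  rw [← Finset.sum_mul, ← Finset.mul_sum, ← sigma_eq_sum, sigma_comp_perm]

theorem hallSum_shift {q sq : ℂ} {z : Fin 4 → ℂ} (hz : ∀ i, z i ≠ 0) (h : sigma 4 z = 1)
    (μ : Fin 4 → ℤ) (k : ℤ) : hallSum q sq z (μ + fun _ => k) = hallSum q sq z μ := by
  have hr : rho (μ + fun _ => k) = rho μ := by
    simp only [rho, Pi.add_apply]
    ring
  refine Finset.sum_congr rfl fun τ _ => ?_
  rw [hr]
  congr 1
  have h1 : ∏ i, z (τ i) = 1 := by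
    rw [← sigma_comp_perm 4 z τ, sigma_eq_sum] at h
    rw [← h]
    have : Finset.powersetCard 4 (Finset.univ : Finset (Fin 4)) = {Finset.univ} := by decide
    rw [this, Finset.sum_singleton]
    rfl
  simp only [Pi.add_apply, zpow_add₀ (hz _), Finset.prod_mul_distrib]
  rw [Finset.prod_zpow, h1, one_zpow, mul_one]

/-- With `a = z (τ k)` and `b = z (τ (k+1))`, the two constants share all factors except `(a - q
b)/(a - b)` and `(b - q a)/(b - a)`. The claim comes down to `(a - q b)(q a - b) = (b - q a)(q b -
a)`. -/
theorem constC_swap {q : ℂ} {z : Fin 4 → ℂ} (hz : Function.Injective z)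
    (τ : Equiv.Perm (Fin 4)) (k : Fin 3) :
    constC q z (τ 0) (τ 1) (τ 2) (τ 3) * (q * z (τ k.castSucc) - z (τ k.succ)) +
      constC q z ((τ * Equiv.swap k.castSucc k.succ) 0) ((τ * Equiv.swap k.castSucc k.succ) 1)
        ((τ * Equiv.swap k.castSucc k.succ) 2) ((τ * Equiv.swap k.castSucc k.succ) 3) *
        (q * z (τ k.succ) - z (τ k.castSucc)) = 0 := by
  have hne : ∀ i j : Fin 4, i ≠ j → z (τ i) - z (τ j) ≠ 0 := fun i j hij =>
    sub_ne_zero.2 fun h => hij (τ.injective (hz h))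
  -- Division by zero then makes both constants vanish.
  by_cases hD : constD q = 0
  · simp [constC, hD]
  have h01 := hne 0 1 (by decide)
  have h02 := hne 0 2 (by decide)
  have h03 := hne 0 3 (by decide)
  have h12 := hne 1 2 (by decide)
  have h13 := hne 1 3 (by decide)
  have h23 := hne 2 3 (by decide)
  have h10 := hne 1 0 (by decide)
  have h21 := hne 2 1 (by decide)
  have h32 := hne 3 2 (by decide)
  fin_cases k
  · have e0 : Equiv.swap (0 : Fin 4) 1 2 = 2 := by decide
    have e1 : Equiv.swap (0 : Fin 4) 1 3 = 3 := by decide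
    simp only [constC, Equiv.Perm.mul_apply, Fin.castSucc_zero, Fin.succ_zero_eq_one,
      Fin.zero_eta, Equiv.swap_apply_left, Equiv.swap_apply_right, e0, e1]
    generalize z (τ 0) = a at *
    generalize z (τ 1) = b at *
    generalize z (τ 2) = c at *
    generalize z (τ 3) = d at *
    generalize constD q = D at *
    field_simp
    ring
  · have e0 : Equiv.swap (1 : Fin 4) 2 0 = 0 := by decide
    have e1 : Equiv.swap (1 : Fin 4) 2 3 = 3 := by decide
    simp only [constC, Equiv.Perm.mul_apply, Fin.mk_one, Fin.castSucc_one,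
      Fin.succ_one_eq_two, Equiv.swap_apply_left, Equiv.swap_apply_right, e0, e1]
    generalize z (τ 0) = a at *
    generalize z (τ 1) = b at *
    generalize z (τ 2) = c at *
    generalize z (τ 3) = d at *
    generalize constD q = D at *
    field_simp
    ring
  · have e0 : Equiv.swap (2 : Fin 4) 3 0 = 0 := by decide
    have e1 : Equiv.swap (2 : Fin 4) 3 1 = 1 := by decide
    have e2 : (2 : Fin 3).castSucc = (2 : Fin 4) := rfl
    have e3 : (2 : Fin 3).succ = (3 : Fin 4) := rfl
    simp only [constC, Equiv.Perm.mul_apply, Fin.reduceFinMk, e2, e3,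
      Equiv.swap_apply_left, Equiv.swap_apply_right, e0, e1]
    generalize z (τ 0) = a at *
    generalize z (τ 1) = b at *
    generalize z (τ 2) = c at *
    generalize z (τ 3) = d at *
    generalize constD q = D at *
    field_simp
    ring

/-- Swapping raises `rho` by `2`, hence contributes a factor `q`. In the difference of the two sums
the summand at `τ` carries `q z (τ k) - z (τ (k+1))`, and by `constC_swap` it cancels the summand at
`τ * s`. -/
theorem hallSum_swapInv {q sq : ℂ} (hsq : sq ^ 2 = q) (h0 : sq ≠ 0) {z : Fin 4 → ℂ}
    (hz : Function.Injective z) (hz0 : ∀ i, z i ≠ 0) : SwapInv (hallSum q sq z) := by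
  intro μ k hk
  set s := Equiv.swap k.castSucc k.succ with hs
  have hrho : rho (μ ∘ s) = 2 + rho μ := by
    have h1 : μ ∘ s = μ + Pi.single k.castSucc 1 - Pi.single k.succ 1 := by
      have hne : k.castSucc ≠ k.succ := Fin.castSucc_lt_succ.ne
      ext i
      by_cases h1 : i = k.castSucc
      · subst h1
        simp [hs, hk, hne]
      · by_cases h2 : i = k.succ
        · subst h2
          simp [hs, hk, hne]
        · simp [hs, Equiv.swap_apply_of_ne_of_ne h1 h2, h1, h2]
    rw [h1]
    fin_cases k <;> simp [rho] <;> ring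
  let g : Equiv.Perm (Fin 4) → ℂ := fun τ =>
    constC q z (τ 0) (τ 1) (τ 2) (τ 3) * sq ^ rho (μ ∘ s) * ∏ i, z (τ i) ^ (μ ∘ s) i -
      constC q z (τ 0) (τ 1) (τ 2) (τ 3) * sq ^ rho μ * ∏ i, z (τ i) ^ μ i
  have hsum : hallSum q sq z (μ ∘ s) - hallSum q sq z μ = ∑ τ, g τ := by
    simp only [hallSum, g, Finset.sum_sub_distrib]
  -- `w` lowers the larger of the two entries to the smaller one. It is fixed by `s`, and the
  -- monomials of `μ` and `μ ∘ s` are its monomial times one variable each.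
  let w : Fin 4 → ℤ := Function.update μ k.succ (μ k.castSucc)
  have hw : ∀ τ : Equiv.Perm (Fin 4),
      ∏ i, z (τ i) ^ μ i = (∏ i, z (τ i) ^ w i) * z (τ k.succ) := by
    intro τ
    have : μ = w + Pi.single k.succ 1 := by
      ext i
      by_cases h2 : i = k.succ
      · subst h2
        simp [w, hk]
      · simp [w, h2]
    conv_lhs => rw [this]
    simp only [Pi.add_apply, zpow_add₀ (hz0 _), Finset.prod_mul_distrib]
    congr 1
    rw [Finset.prod_eq_single k.succ] <;> simp +contextual
  have hwinv : ∀ i, w (s i) = w i := by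
    intro i
    have hne : k.castSucc ≠ k.succ := Fin.castSucc_lt_succ.ne
    by_cases h1 : i = k.castSucc
    · subst h1
      simp [w, hs, hne]
    · by_cases h2 : i = k.succ
      · subst h2
        simp [w, hs, hne]
      · simp [hs, Equiv.swap_apply_of_ne_of_ne h1 h2]
  have hprod : ∀ (τ : Equiv.Perm (Fin 4)) (ν : Fin 4 → ℤ),
      ∏ i, z ((τ * s) i) ^ ν i = ∏ i, z (τ i) ^ (ν ∘ s) i := by
    intro τ ν
    rw [← Equiv.prod_comp s]
    simp [hs]
  have hw2 : ∀ τ : Equiv.Perm (Fin 4), ∏ i, z ((τ * s) i) ^ w i = ∏ i, z (τ i) ^ w i := by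
    intro τ
    rw [hprod]
    simp [hwinv]
  have hpair : ∀ τ, g τ + g (τ * s) = 0 := by
    intro τ
    have e1 : ∏ i, z (τ i) ^ (μ ∘ s) i = (∏ i, z (τ i) ^ w i) * z (τ k.castSucc) := by
      rw [← hprod, hw, hw2]
      simp [hs]
    have e2 : ∏ i, z ((τ * s) i) ^ (μ ∘ s) i = (∏ i, z (τ i) ^ w i) * z (τ k.succ) := by
      rw [hprod, ← hw]
      simp [hs]
    have e3 : ∏ i, z ((τ * s) i) ^ μ i = (∏ i, z (τ i) ^ w i) * z (τ k.castSucc) := by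
      rw [hw, hw2]
      simp [hs]
    have hc := constC_swap (q := q) hz τ k
    have h2 : sq ^ (2 : ℤ) = q := by exact_mod_cast hsq
    simp only [g, e1, e2, e3, hw τ, hrho, zpow_add₀ h0, h2]
    linear_combination sq ^ rho μ * (∏ i, z (τ i) ^ w i) * hc
  -- Summing the pair relation over all `τ` counts every summand twice, so twice the difference is
  -- zero.
  have h2 : ∑ τ, g (τ * s) = ∑ τ, g τ := Equiv.sum_comp (Equiv.mulRight s) g
  have h3 : ∑ τ, g τ + ∑ τ, g (τ * s) = 0 := by
    rw [← Finset.sum_add_distrib]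
    exact Finset.sum_eq_zero fun τ _ => hpair τ
  rw [h2, ← hsum] at h3
  linear_combination h3 / 2

theorem sum_perm_fin_four (g : Fin 4 → Fin 4 → Fin 4 → Fin 4 → ℂ) :
    ∑ τ : Equiv.Perm (Fin 4), g (τ 0) (τ 1) (τ 2) (τ 3) =
      (g 0 1 2 3 + g 0 1 3 2 + (g 0 2 1 3 + g 0 2 3 1) + (g 0 3 1 2 + g 0 3 2 1)) +
      (g 1 0 2 3 + g 1 0 3 2 + (g 1 2 0 3 + g 1 2 3 0) + (g 1 3 0 2 + g 1 3 2 0)) +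
      (g 2 0 1 3 + g 2 0 3 1 + (g 2 1 0 3 + g 2 1 3 0) + (g 2 3 0 1 + g 2 3 1 0)) +
      (g 3 0 1 2 + g 3 0 2 1 + (g 3 1 0 2 + g 3 1 2 0) + (g 3 2 0 1 + g 3 2 1 0)) := by
  have hval : (Finset.univ : Finset (Equiv.Perm (Fin 4))).val.map (fun τ => (τ 0, τ 1, τ 2, τ 3)) =
      ({
        (0, 1, 2, 3), (0, 1, 3, 2), (0, 2, 1, 3), (0, 2, 3, 1), (0, 3, 1, 2), (0, 3, 2, 1),
        (1, 0, 2, 3), (1, 0, 3, 2), (1, 2, 0, 3), (1, 2, 3, 0), (1, 3, 0, 2), (1, 3, 2, 0),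
        (2, 0, 1, 3), (2, 0, 3, 1), (2, 1, 0, 3), (2, 1, 3, 0), (2, 3, 0, 1), (2, 3, 1, 0),
        (3, 0, 1, 2), (3, 0, 2, 1), (3, 1, 0, 2), (3, 1, 2, 0), (3, 2, 0, 1), (3, 2, 1, 0)} :
        Multiset (Fin 4 × Fin 4 × Fin 4 × Fin 4)) := by
    decide
  have hmap : ∑ τ : Equiv.Perm (Fin 4), g (τ 0) (τ 1) (τ 2) (τ 3) =
      (((Finset.univ : Finset (Equiv.Perm (Fin 4))).val.map
        (fun τ => (τ 0, τ 1, τ 2, τ 3))).map fun p => g p.1 p.2.1 p.2.2.1 p.2.2.2).sum := by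
    rw [Multiset.map_map]
    rfl
  rw [hmap, hval]
  simp only [Multiset.insert_eq_cons, Multiset.map_cons, Multiset.map_singleton,
    Multiset.sum_cons, Multiset.sum_singleton]
  ring

/-- Macdonald's identity: summing the product over `i < j` of `(z_{τ i} - q z_{τ j})/(z_{τ i} - z_{τ
j})` over `S₄` gives `D`. It peels off one variable at a time, since the sum over `i` of the product
over `j ≠ i` of these quotients is `1 + q + ⋯ + q^(n-1)` for `n` variables, here with `n = 2, 3, 4`.
-/
theorem hallSum_zero {q sq : ℂ} (hD : constD q ≠ 0) {z : Fin 4 → ℂ} (hz : Function.Injective z) :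
    hallSum q sq z 0 = 1 := by
  have hne : ∀ i j : Fin 4, i ≠ j → z i - z j ≠ 0 := fun i j hij =>
    sub_ne_zero.2 fun h => hij (hz h)
  let h : Fin 4 → Fin 4 → ℂ := fun i j => (z i - q * z j) / (z i - z j)
  have hC : ∀ i j k l, constC q z i j k l =
      h i j * h i k * h i l * (h j k * h j l * h k l) / constD q := by
    intro i j k l
    simp only [constC, h, div_mul_div_comm, div_div]
    congr 1 <;> ring
  have two : ∀ i j : Fin 4, i ≠ j → h i j + h j i = 1 + q := by
    intro i j hij
    have h1 := hne i j hij
    have h2 := hne j i hij.symm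
    simp only [h]
    generalize z i = a at *
    generalize z j = b at *
    field_simp
    ring
  have three : ∀ i j k : Fin 4, i ≠ j → i ≠ k → j ≠ k →
      h i j * h i k + h j i * h j k + h k i * h k j = 1 + q + q ^ 2 := by
    intro i j k hij hik hjk
    have h1 := hne i j hij
    have h2 := hne j i hij.symm
    have h3 := hne i k hik
    have h4 := hne k i hik.symm
    have h5 := hne j k hjk
    have h6 := hne k j hjk.symm
    simp only [h]
    generalize z i = a at *
    generalize z j = b at *
    generalize z k = c at *
    field_simp
    ring
  have four : h 0 1 * h 0 2 * h 0 3 + h 1 0 * h 1 2 * h 1 3 + h 2 0 * h 2 1 * h 2 3 +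
      h 3 0 * h 3 1 * h 3 2 = 1 + q + q ^ 2 + q ^ 3 := by
    have h01 := hne 0 1 (by decide)
    have h02 := hne 0 2 (by decide)
    have h03 := hne 0 3 (by decide)
    have h12 := hne 1 2 (by decide)
    have h13 := hne 1 3 (by decide)
    have h23 := hne 2 3 (by decide)
    have h10 := hne 1 0 (by decide)
    have h20 := hne 2 0 (by decide)
    have h30 := hne 3 0 (by decide)
    have h21 := hne 2 1 (by decide)
    have h31 := hne 3 1 (by decide)
    have h32 := hne 3 2 (by decide)
    simp only [h]
    generalize z 0 = a at *
    generalize z 1 = b at *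
    generalize z 2 = c at *
    generalize z 3 = d at *
    field_simp
    ring
  clear_value h
  have inner : ∀ i j k l : Fin 4, j ≠ k → j ≠ l → k ≠ l →
      (constC q z i j k l + constC q z i j l k + (constC q z i k j l + constC q z i k l j) +
        (constC q z i l j k + constC q z i l k j)) =
      h i j * h i k * h i l * ((1 + q + q ^ 2) * (1 + q)) / constD q := by
    intro i j k l hjk hjl hkl
    have e0 := three j k l hjk hjl hkl
    simp only [hC]
    have e1 := two k l hkl
    have e2 := two j l hjl
    have e3 := two j k hjk
    rw [← add_div, ← add_div, ← add_div, ← add_div, ← add_div]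
    congr 1
    linear_combination h i j * h i k * h i l *
      (h j k * h j l * e1 + h k j * h k l * e2 + h l j * h l k * e3 + (1 + q) * e0)
  have hr : rho 0 = 0 := by simp [rho]
  simp only [hallSum, hr, zpow_zero, mul_one, Pi.zero_apply, Finset.prod_const_one]
  generalize constC q z = C at inner ⊢
  rw [sum_perm_fin_four C, inner 0 1 2 3 (by decide) (by decide) (by decide),
    inner 1 0 2 3 (by decide) (by decide) (by decide),
    inner 2 0 1 3 (by decide) (by decide) (by decide),
    inner 3 0 1 2 (by decide) (by decide) (by decide)]
  simp only [← add_div]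
  rw [div_eq_one_iff_eq hD, constD]
  linear_combination (1 + q + q ^ 2) * (1 + q) * four

/-! ### The field `F = 𝔽_q((t⁻¹))` and diagonal matrices -/

theorem tElt_ne_zero (K : Type*) [Field K] : tElt K ≠ 0 :=
  HahnSeries.single_ne_zero one_ne_zero

theorem tElt_zpow (K : Type*) [Field K] (k : ℤ) : tElt K ^ k = HahnSeries.single (-k) 1 := by
  rw [RatFunc.single_zpow, zpow_neg, ← inv_zpow]
  congr 1
  rw [tElt, HahnSeries.inv_single, inv_one]

theorem algebraMap_X_eq (K : Type*) [Field K] :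
    algebraMap K⟦X⟧ K⸨X⸩ PowerSeries.X = tElt K ^ (-1 : ℤ) := by
  rw [tElt_zpow, LaurentSeries.coe_algebraMap, HahnSeries.ofPowerSeries_X]
  rfl

theorem algebraMap_C_eq {K : Type*} [Field K] (a : K) :
    algebraMap K⟦X⟧ K⸨X⸩ (PowerSeries.C a) = HahnSeries.C a := by
  rw [LaurentSeries.coe_algebraMap, HahnSeries.ofPowerSeries_C]

theorem algebraMap_laurent_injective (K : Type*) [Field K] :
    Function.Injective (algebraMap K⟦X⟧ K⸨X⸩) := by
  rw [LaurentSeries.coe_algebraMap]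
  exact HahnSeries.ofPowerSeries_injective

theorem coeff_algebraMap_of_neg {K : Type*} [Field K] (p : K⟦X⟧) {m : ℤ} (hm : m < 0) :
    (algebraMap K⟦X⟧ K⸨X⸩ p).coeff m = 0 := by
  rw [LaurentSeries.coe_algebraMap, PowerSeries.coeff_coe, if_pos hm]

theorem exists_unit_mul_zpow {K : Type*} [Field K] {u : K⸨X⸩} (hu : u ≠ 0) :
    ∃ (p : K⟦X⟧ˣ) (k : ℤ), u = algebraMap K⟦X⟧ K⸨X⸩ p * tElt K ^ k := by
  have hp : IsUnit u.powerSeriesPart := by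
    rw [PowerSeries.isUnit_iff_constantCoeff, ← PowerSeries.coeff_zero_eq_constantCoeff_apply,
      LaurentSeries.powerSeriesPart_coeff, isUnit_iff_ne_zero]
    simpa using hu
  obtain ⟨p, hp⟩ := hp
  refine ⟨p, -u.order, ?_⟩
  rw [tElt_zpow, neg_neg, hp, mul_comm, LaurentSeries.coe_algebraMap,
    LaurentSeries.single_order_mul_powerSeriesPart]

theorem coeff_polyEmb {K : Type*} [Field K] (p : Polynomial K) (n : ℕ) :
    (polyEmb K p).coeff (-n) = p.coeff n := by
  induction p using Polynomial.induction_on' with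
  | add p q hp hq => rw [map_add, HahnSeries.coeff_add, hp, hq, Polynomial.coeff_add]
  | monomial m a =>
    have h : polyEmb K (Polynomial.monomial m a) = HahnSeries.single (-(m : ℤ)) a := by
      simp only [polyEmb, Polynomial.coe_eval₂RingHom, Polynomial.eval₂_monomial]
      rw [← zpow_natCast, tElt_zpow, HahnSeries.C_apply, HahnSeries.single_mul_single, zero_add,
        mul_one]
    rw [h, Polynomial.coeff_monomial, HahnSeries.coeff_single]
    split_ifs <;> first | rfl | omega

/-- Power series in `t⁻¹` have no positive powers of `t`, so integrality of `p t^k` bounds the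
degree of `p` by `-k`. -/
theorem coeff_eq_zero_of_polyEmb_mul_zpow {K : Type*} [Field K] {p : Polynomial K} {k : ℤ}
    {s : K⟦X⟧} (h : polyEmb K p * tElt K ^ k = algebraMap K⟦X⟧ K⸨X⸩ s) {n : ℕ} (hn : 0 < n + k) :
    p.coeff n = 0 := by
  have h1 := coeff_algebraMap_of_neg s (m := -n + -k) (by omega)
  rwa [← h, tElt_zpow, HahnSeries.coeff_mul_single_add, mul_one, coeff_polyEmb] at h1

/-- The diagonal matrix `diag(t^μ₀, …, t^μ₃)`. -/
def tDiag (K : Type*) [Field K] (μ : Fin 4 → ℤ) : GL (Fin 4) K⸨X⸩ where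
  val := Matrix.diagonal fun i => tElt K ^ μ i
  inv := Matrix.diagonal fun i => tElt K ^ (-μ i)
  val_inv := by
    rw [Matrix.diagonal_mul_diagonal, ← Matrix.diagonal_one]
    simp only [← zpow_add₀ (tElt_ne_zero K), add_neg_cancel, zpow_zero]
  inv_val := by
    rw [Matrix.diagonal_mul_diagonal, ← Matrix.diagonal_one]
    simp only [← zpow_add₀ (tElt_ne_zero K), neg_add_cancel, zpow_zero]

theorem coe_tDiag {K : Type*} [Field K] (μ : Fin 4 → ℤ) :
    (tDiag K μ : Matrix (Fin 4) (Fin 4) K⸨X⸩) = Matrix.diagonal fun i => tElt K ^ μ i := rfl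

theorem tDiag_add {K : Type*} [Field K] (μ ν : Fin 4 → ℤ) :
    tDiag K (μ + ν) = tDiag K μ * tDiag K ν := by
  ext1
  rw [Units.val_mul, coe_tDiag, coe_tDiag, coe_tDiag, Matrix.diagonal_mul_diagonal]
  simp [zpow_add₀ (tElt_ne_zero K)]

theorem tDiag_zero (K : Type*) [Field K] : tDiag K 0 = 1 := by
  ext1
  simp [coe_tDiag]

theorem tDiag_neg {K : Type*} [Field K] (μ : Fin 4 → ℤ) : tDiag K (-μ) = (tDiag K μ)⁻¹ := by
  rw [eq_inv_iff_mul_eq_one, ← tDiag_add, neg_add_cancel, tDiag_zero]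

/-- `t` as a unit. -/
def tUnit (K : Type*) [Field K] : K⸨X⸩ˣ := Units.mk0 (tElt K) (tElt_ne_zero K)

theorem tDiag_const (K : Type*) [Field K] (k : ℤ) :
    tDiag K (fun _ => k) = Matrix.GeneralLinearGroup.scalar (Fin 4) (tUnit K ^ k) := by
  ext1
  rw [coe_tDiag, Matrix.GeneralLinearGroup.coe_scalar, Units.val_zpow_eq_zpow_val]
  rfl

theorem tDiag_const_comm {K : Type*} [Field K] (k : ℤ) (g : GL (Fin 4) K⸨X⸩) :
    tDiag K (fun _ => k) * g = g * tDiag K (fun _ => k) := by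
  rw [tDiag_const, Matrix.GeneralLinearGroup.scalar_commute]

theorem diagMat_eq {K : Type*} [Field K] (l m n : ℕ) :
    diagMat K l m n = tDiag K ![(l : ℤ), m, n, 0] := by
  ext1
  rw [coe_tDiag]
  change Matrix.diagonal _ = _
  congr 1
  ext i
  fin_cases i <;> simp

/-! ### Equality of vertices and of orbits -/

/-- The embedding `GL(4, 𝒪) → GL(4, F)`. -/
abbrev intGL {K : Type*} [Field K] : GL (Fin 4) K⟦X⟧ →* GL (Fin 4) K⸨X⸩ :=
  Matrix.GeneralLinearGroup.map (algebraMap K⟦X⟧ K⸨X⸩)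

/-- The embedding `GL(4, 𝔽_q[t]) → GL(4, F)`. -/
abbrev polyGL {K : Type*} [Field K] : GL (Fin 4) (Polynomial K) →* GL (Fin 4) K⸨X⸩ :=
  Matrix.GeneralLinearGroup.map (polyEmb K)

theorem coe_intGL {K : Type*} [Field K] (w : GL (Fin 4) K⟦X⟧) :
    (intGL w : Matrix (Fin 4) (Fin 4) K⸨X⸩) =
      (w : Matrix (Fin 4) (Fin 4) K⟦X⟧).map (algebraMap K⟦X⟧ K⸨X⸩) := rfl

theorem coe_polyGL {K : Type*} [Field K] (P : GL (Fin 4) (Polynomial K)) :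
    (polyGL P : Matrix (Fin 4) (Fin 4) K⸨X⸩) =
      (P : Matrix (Fin 4) (Fin 4) (Polynomial K)).map (polyEmb K) := rfl

/-- A scalar of `F` is a unit of `𝒪` times a power of `t`; the unit is absorbed in `w`. -/
theorem vertexOf_eq_iff {K : Type*} [Field K] {g h : GL (Fin 4) K⸨X⸩} :
    vertexOf g = vertexOf h ↔
      ∃ (w : GL (Fin 4) K⟦X⟧) (k : ℤ), h = g * intGL w * tDiag K (fun _ => k) := by
  unfold vertexOf
  rw [QuotientGroup.eq, ← map_inv, ← map_mul]
  constructor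
  · rintro ⟨x, hx⟩
    obtain ⟨w, rfl⟩ := Matrix.ProjGenLinGroup.mk_surjective x
    rw [Matrix.ProjGenLinGroup.map_mk, Matrix.ProjGenLinGroup.mk_eq_mk_iff] at hx
    obtain ⟨u, hu⟩ := hx
    obtain ⟨p, k, hp⟩ := exists_unit_mul_zpow u.ne_zero
    refine ⟨w * Matrix.GeneralLinearGroup.scalar (Fin 4) p, k, ?_⟩
    have h1 : u = Units.map (algebraMap K⟦X⟧ K⸨X⸩).toMonoidHom p * tUnit K ^ k := by
      ext1
      rw [hp, Units.val_mul, Units.val_zpow_eq_zpow_val]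
      rfl
    rw [map_mul, Matrix.GeneralLinearGroup.map_scalar, tDiag_const, mul_assoc, mul_assoc,
      ← map_mul]
    change h = g * (intGL w * (Matrix.GeneralLinearGroup.scalar (Fin 4)
      (Units.map (algebraMap K⟦X⟧ K⸨X⸩).toMonoidHom p * tUnit K ^ k)))
    rw [← h1, hu, mul_inv_cancel_left]
  · rintro ⟨w, k, rfl⟩
    refine ⟨Matrix.ProjGenLinGroup.mk w, ?_⟩
    rw [Matrix.ProjGenLinGroup.map_mk, Matrix.ProjGenLinGroup.mk_eq_mk_iff]
    refine ⟨tUnit K ^ k, ?_⟩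
    rw [tDiag_const, mul_assoc, inv_mul_cancel_left]

theorem vertexOf_mul_intGL {K : Type*} [Field K] (g : GL (Fin 4) K⸨X⸩) (w : GL (Fin 4) K⟦X⟧) :
    vertexOf (g * intGL w) = vertexOf g :=
  (vertexOf_eq_iff.2 ⟨w, 0, by
    rw [show (fun _ : Fin 4 => (0 : ℤ)) = 0 from rfl, tDiag_zero, mul_one]⟩).symm

theorem vertexOf_mul_tDiag_const {K : Type*} [Field K] (g : GL (Fin 4) K⸨X⸩) (k : ℤ) :
    vertexOf (g * tDiag K (fun _ => k)) = vertexOf g :=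
  (vertexOf_eq_iff.2 ⟨1, k, by rw [map_one, mul_one]⟩).symm

theorem vertexOf_surjective {K : Type*} [Field K] :
    Function.Surjective (vertexOf : GL (Fin 4) K⸨X⸩ → Vertex K) := by
  intro x
  obtain ⟨y, rfl⟩ := QuotientGroup.mk_surjective x
  obtain ⟨g, rfl⟩ := Matrix.ProjGenLinGroup.mk_surjective y
  exact ⟨g, rfl⟩

/-- The element of `Γ` attached to a polynomial matrix. -/
def gamOf {K : Type*} [Field K] (P : GL (Fin 4) (Polynomial K)) : Gam K :=
  ⟨Matrix.ProjGenLinGroup.mk (polyGL P), Matrix.ProjGenLinGroup.mk P, rfl⟩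

theorem gamOf_surjective {K : Type*} [Field K] :
    Function.Surjective (gamOf : GL (Fin 4) (Polynomial K) → Gam K) := by
  rintro ⟨_, x, rfl⟩
  obtain ⟨P, rfl⟩ := Matrix.ProjGenLinGroup.mk_surjective x
  exact ⟨P, rfl⟩

theorem gamOf_smul_vertexOf {K : Type*} [Field K] (P : GL (Fin 4) (Polynomial K))
    (g : GL (Fin 4) K⸨X⸩) : gamOf P • vertexOf g = vertexOf (polyGL P * g) := rfl

theorem toQ_eq_iff {K : Type*} [Field K] {x y : Vertex K} :
    toQ x = toQ y ↔ ∃ γ : Gam K, γ • y = x := by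
  unfold toQ
  rw [Quotient.eq'']
  exact Iff.rfl

theorem toQ_vertexOf_eq_iff {K : Type*} [Field K] {g h : GL (Fin 4) K⸨X⸩} :
    toQ (vertexOf g) = toQ (vertexOf h) ↔
      ∃ (P : GL (Fin 4) (Polynomial K)) (w : GL (Fin 4) K⟦X⟧) (k : ℤ),
        h = polyGL P * g * intGL w * tDiag K (fun _ => k) := by
  rw [eq_comm, toQ_eq_iff]
  constructor
  · rintro ⟨γ, hγ⟩
    obtain ⟨P, rfl⟩ := gamOf_surjective γ
    rw [gamOf_smul_vertexOf, vertexOf_eq_iff] at hγ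
    exact ⟨P, hγ⟩
  · rintro ⟨P, hP⟩
    refine ⟨gamOf P, ?_⟩
    rw [gamOf_smul_vertexOf, vertexOf_eq_iff]
    exact hP

theorem toQ_polyGL_mul {K : Type*} [Field K] (P : GL (Fin 4) (Polynomial K))
    (g : GL (Fin 4) K⸨X⸩) : toQ (vertexOf (polyGL P * g)) = toQ (vertexOf g) :=
  toQ_eq_iff.2 ⟨gamOf P, rfl⟩

/-! ### Colours -/

theorem color_vertexOf {K : Type*} [Field K] (g : GL (Fin 4) K⸨X⸩) :
    color (vertexOf g) = Multiplicative.toAdd (degDet K g) := rfl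

theorem color_vertexOf_mul {K : Type*} [Field K] (g h : GL (Fin 4) K⸨X⸩) :
    color (vertexOf (g * h)) = color (vertexOf g) + color (vertexOf h) := by
  simp only [color_vertexOf, map_mul, toAdd_mul]

theorem color_intGL {K : Type*} [Field K] (w : GL (Fin 4) K⟦X⟧) :
    color (vertexOf (intGL w)) = 0 := by
  have h := degDetPGL_W (Matrix.ProjGenLinGroup.mk (intGL w)) ⟨Matrix.ProjGenLinGroup.mk w, rfl⟩
  exact congrArg Multiplicative.toAdd h

theorem color_tDiag {K : Type*} [Field K] (μ : Fin 4 → ℤ) :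
    color (vertexOf (tDiag K μ)) = ((∑ i, μ i : ℤ) : ZMod 4) := by
  have h : Matrix.det (tDiag K μ : Matrix (Fin 4) (Fin 4) K⸨X⸩) = tElt K ^ (∑ i, μ i) := by
    rw [coe_tDiag, Matrix.det_diagonal]
    simp [Fin.prod_univ_four, Fin.sum_univ_four, zpow_add₀ (tElt_ne_zero K)]
  change (((-(HahnSeries.order (Matrix.det (tDiag K μ : Matrix (Fin 4) (Fin 4) K⸨X⸩))) : ℤ)) :
    ZMod 4) = _
  rw [h, tElt_zpow, HahnSeries.order_single one_ne_zero, neg_neg]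

/-! ### Lattices and adjacency -/

theorem mem_lattice {K : Type*} [Field K] {g : GL (Fin 4) K⸨X⸩} {x : Fin 4 → K⸨X⸩} :
    x ∈ lattice g ↔ ∃ y : Fin 4 → K⟦X⟧,
      (g : Matrix (Fin 4) (Fin 4) K⸨X⸩).mulVec (fun i => algebraMap K⟦X⟧ K⸨X⸩ (y i)) = x := by
  rw [lattice, Submodule.mem_span_range_iff_exists_fun]
  refine exists_congr fun y => ?_
  have : ∑ i, y i • (g : Matrix (Fin 4) (Fin 4) K⸨X⸩).col i =
      (g : Matrix (Fin 4) (Fin 4) K⸨X⸩).mulVec (fun i => algebraMap K⟦X⟧ K⸨X⸩ (y i)) := by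
    ext1 j
    rw [Finset.sum_apply, Matrix.mulVec, dotProduct]
    refine Finset.sum_congr rfl fun i _ => ?_
    rw [Pi.smul_apply, Algebra.smul_def, mul_comm]
    rfl
  rw [this]

theorem lattice_le_iff {K : Type*} [Field K] {g h : GL (Fin 4) K⸨X⸩} :
    lattice h ≤ lattice g ↔ ∃ A : Matrix (Fin 4) (Fin 4) K⟦X⟧,
      (h : Matrix (Fin 4) (Fin 4) K⸨X⸩) = g * A.map (algebraMap K⟦X⟧ K⸨X⸩) := by
  constructor
  · intro hle
    have h1 : ∀ j, ∃ y : Fin 4 → K⟦X⟧,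
        (g : Matrix (Fin 4) (Fin 4) K⸨X⸩).mulVec (fun i => algebraMap K⟦X⟧ K⸨X⸩ (y i)) =
          (h : Matrix (Fin 4) (Fin 4) K⸨X⸩).col j := fun j =>
      mem_lattice.1 (hle (Submodule.subset_span ⟨j, rfl⟩))
    choose y hy using h1
    refine ⟨Matrix.of fun i j => y j i, ?_⟩
    ext1 i j
    exact (congrFun (hy j) i).symm
  · rintro ⟨A, hA⟩ x hx
    obtain ⟨y, rfl⟩ := mem_lattice.1 hx
    refine mem_lattice.2 ⟨A.mulVec y, ?_⟩
    rw [hA, ← Matrix.mulVec_mulVec]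
    congr 1
    ext1 i
    simp [Matrix.mulVec, dotProduct]

theorem map_algebraMap_injective {K : Type*} [Field K] {A B : Matrix (Fin 4) (Fin 4) K⟦X⟧}
    (h : A.map (algebraMap K⟦X⟧ K⸨X⸩) = B.map (algebraMap K⟦X⟧ K⸨X⸩)) : A = B :=
  Matrix.map_injective (algebraMap_laurent_injective K) h

theorem lattice_lt_iff {K : Type*} [Field K] {g h : GL (Fin 4) K⸨X⸩} :
    lattice h < lattice g ↔ ∃ A : Matrix (Fin 4) (Fin 4) K⟦X⟧, ¬ IsUnit A ∧
      (h : Matrix (Fin 4) (Fin 4) K⸨X⸩) = g * A.map (algebraMap K⟦X⟧ K⸨X⸩) := by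
  rw [lt_iff_le_not_ge, lattice_le_iff]
  constructor
  · rintro ⟨⟨A, hA⟩, hn⟩
    refine ⟨A, fun hu => hn ?_, hA⟩
    obtain ⟨w, rfl⟩ := hu
    refine lattice_le_iff.2 ⟨(w⁻¹ : GL (Fin 4) K⟦X⟧), ?_⟩
    rw [hA, mul_assoc, ← Matrix.map_mul, Units.mul_inv]
    simp
  · rintro ⟨A, hu, hA⟩
    refine ⟨⟨A, hA⟩, fun hle => hu ?_⟩
    obtain ⟨B, hB⟩ := lattice_le_iff.1 hle
    have h1 : (g : Matrix (Fin 4) (Fin 4) K⸨X⸩) * 1 =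
        g * (A * B).map (algebraMap K⟦X⟧ K⸨X⸩) := by
      rw [Matrix.map_mul, ← mul_assoc, ← hA, ← hB, mul_one]
    have h2 := g.isUnit.mul_left_cancel h1
    have h3 : A * B = 1 := map_algebraMap_injective (by rw [← h2]; simp)
    exact IsUnit.of_mul_eq_one B h3

theorem X_smul_lattice {K : Type*} [Field K] (g : GL (Fin 4) K⸨X⸩) :
    (PowerSeries.X : K⟦X⟧) • lattice g = lattice (g * tDiag K fun _ => -1) := by
  have hg : ∀ y : Fin 4 → K⸨X⸩,
      ((g * tDiag K fun _ => -1 : GL (Fin 4) K⸨X⸩) : Matrix (Fin 4) (Fin 4) K⸨X⸩).mulVec y =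
        (PowerSeries.X : K⟦X⟧) • (g : Matrix (Fin 4) (Fin 4) K⸨X⸩).mulVec y := by
    intro y
    rw [← tDiag_const_comm, Units.val_mul, ← Matrix.mulVec_mulVec]
    ext1 i
    rw [coe_tDiag, Matrix.mulVec_diagonal, Pi.smul_apply, Algebra.smul_def, algebraMap_X_eq]
  ext x
  rw [Submodule.mem_smul_pointwise_iff_exists, mem_lattice]
  constructor
  · rintro ⟨_, hy, rfl⟩
    obtain ⟨y, rfl⟩ := mem_lattice.1 hy
    exact ⟨y, hg _⟩
  · rintro ⟨y, rfl⟩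
    exact ⟨_, mem_lattice.2 ⟨y, rfl⟩, (hg _).symm⟩

/-- The chain `πL ⊊ L' ⊊ L` is a factorisation of `π` into two integral matrices, and strictness
means that neither factor is invertible over `𝒪`. -/
theorem adj_iff {K : Type*} [Field K] {g : GL (Fin 4) K⸨X⸩} {y : Vertex K} :
    Adj (vertexOf g) y ↔ ∃ (k : GL (Fin 4) K⸨X⸩) (A B : Matrix (Fin 4) (Fin 4) K⟦X⟧),
      (k : Matrix (Fin 4) (Fin 4) K⸨X⸩) = A.map (algebraMap K⟦X⟧ K⸨X⸩) ∧
      A * B = Matrix.diagonal (fun _ => PowerSeries.X) ∧ ¬ IsUnit A ∧ ¬ IsUnit B ∧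
      y = vertexOf (g * k) := by
  have hX : (tDiag K fun _ => -1 : Matrix (Fin 4) (Fin 4) K⸨X⸩) =
      (Matrix.diagonal (fun _ : Fin 4 => (PowerSeries.X : K⟦X⟧))).map
        (algebraMap K⟦X⟧ K⸨X⸩) := by
    rw [coe_tDiag, Matrix.diagonal_map (map_zero _)]
    simp only [algebraMap_X_eq]
  constructor
  · rintro ⟨g', h', hg, rfl, h1, h2⟩
    rw [X_smul_lattice, lattice_lt_iff] at h1
    rw [lattice_lt_iff] at h2
    obtain ⟨B, hBu, hB⟩ := h1
    obtain ⟨A, hAu, hA⟩ := h2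
    obtain ⟨w, c, rfl⟩ := vertexOf_eq_iff.1 hg.symm
    have hAB : A * B = Matrix.diagonal (fun _ => PowerSeries.X) := by
      refine map_algebraMap_injective ?_
      rw [← hX, Matrix.map_mul]
      refine (g * intGL w * tDiag K fun _ => c).isUnit.mul_left_cancel ?_
      rw [← mul_assoc, ← hA, ← hB, Units.val_mul]
    -- Passing from the representative `g w t^c` back to `g` multiplies `A` by `w`, multiplies `B`
    -- by `w⁻¹`, and drops the scalar.
    refine ⟨g⁻¹ * h' * tDiag K (fun _ => -c), w * A, B * (w⁻¹ : GL (Fin 4) K⟦X⟧), ?_, ?_, ?_, ?_,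
      ?_⟩
    · rw [Matrix.map_mul, ← coe_intGL, Units.val_mul, Units.val_mul, hA]
      have hc : tDiag K (fun _ => -c) = (tDiag K (fun _ => c))⁻¹ := tDiag_neg _
      have e1 : ((g * intGL w * tDiag K fun _ => c : GL (Fin 4) K⸨X⸩) :
          Matrix (Fin 4) (Fin 4) K⸨X⸩) * A.map (algebraMap K⟦X⟧ K⸨X⸩) =
          (g * intGL w : GL (Fin 4) K⸨X⸩) * (A.map (algebraMap K⟦X⟧ K⸨X⸩) * tDiag K fun _ => c) := by
        have : Commute (tDiag K (fun _ => c) : Matrix (Fin 4) (Fin 4) K⸨X⸩)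
            (A.map (algebraMap K⟦X⟧ K⸨X⸩)) := by
          rw [tDiag_const, Matrix.GeneralLinearGroup.coe_scalar]
          exact Matrix.scalar_commute _ (fun r => Commute.all _ _) _
        rw [Units.val_mul, mul_assoc, this.eq]
      rw [e1, hc, mul_assoc, mul_assoc, mul_assoc, Units.mul_inv, mul_one, Units.val_mul,
        ← mul_assoc, ← mul_assoc, Units.inv_mul, one_mul]
    · rw [mul_assoc, ← mul_assoc A, hAB]
      have : Commute (Matrix.diagonal (fun _ => PowerSeries.X))
          (w : Matrix (Fin 4) (Fin 4) K⟦X⟧) := Matrix.scalar_commute _ (fun r => Commute.all _ _) _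
      rw [← mul_assoc, ← this.eq, mul_assoc, Units.mul_inv, mul_one]
    · rwa [Units.isUnit_units_mul]
    · rwa [Units.isUnit_mul_units]
    · rw [← mul_assoc, mul_inv_cancel_left, vertexOf_mul_tDiag_const]
  · rintro ⟨k, A, B, hk, hAB, hA, hB, rfl⟩
    refine ⟨g, g * k, rfl, rfl, ?_, ?_⟩
    · rw [X_smul_lattice, lattice_lt_iff]
      refine ⟨B, hB, ?_⟩
      rw [Units.val_mul, Units.val_mul, mul_assoc, hk, ← Matrix.map_mul, hAB, hX]
    · rw [lattice_lt_iff]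
      exact ⟨A, hA, by rw [Units.val_mul, hk]⟩

/-! ### Neighbours of a vertex and Schubert cells -/

/-- The projection onto the coordinates in `S`. -/
def pivotProj (K : Type*) [Field K] (S : Finset (Fin 4)) : Matrix (Fin 4) (Fin 4) K :=
  Matrix.diagonal fun i => if i ∈ S then 1 else 0

/-- The diagonal matrix with entries `1` on `S` and the uniformizer off `S`. -/
def pivotDiag (K : Type*) [Field K] (S : Finset (Fin 4)) : Matrix (Fin 4) (Fin 4) K⟦X⟧ :=
  Matrix.diagonal fun i => if i ∈ S then 1 else PowerSeries.X

theorem pivotDiag_map_constantCoeff (K : Type*) [Field K] (S : Finset (Fin 4)) :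
    (pivotDiag K S).map (PowerSeries.constantCoeff (R := K)) = pivotProj K S := by
  rw [pivotDiag, Matrix.diagonal_map (map_zero _), pivotProj]
  congr 1
  ext i
  split_ifs <;> simp

theorem pivotDiag_map_algebraMap (K : Type*) [Field K] (S : Finset (Fin 4)) :
    (pivotDiag K S).map (algebraMap K⟦X⟧ K⸨X⸩) = (tDiag K (ind S + fun _ => -1)) := by
  rw [pivotDiag, Matrix.diagonal_map (map_zero _), coe_tDiag]
  congr 1
  ext1 i
  simp only [ind, Pi.add_apply]
  split_ifs
  · simp
  · rw [zero_add, algebraMap_X_eq]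

theorem inCell_iff_range {K : Type*} [Field K] (S : Finset (Fin 4)) (c : CellIndex S → K)
    (x : Fin 4 → K) : InCell S c x ↔ ∃ y, (unip S c * pivotProj K S).mulVec y = x := by
  rw [inCell_iff]
  constructor
  · intro h
    refine ⟨(unip S (-c)).mulVec x, ?_⟩
    have h1 : (pivotProj K S).mulVec ((unip S (-c)).mulVec x) = (unip S (-c)).mulVec x := by
      ext1 i
      rw [pivotProj, Matrix.mulVec_diagonal]
      split_ifs with hi
      · rw [one_mul]
      · rw [h i hi, zero_mul]
    rw [← Matrix.mulVec_mulVec, h1, Matrix.mulVec_mulVec, unip_mul, add_neg_cancel, unip_zero,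
      Matrix.one_mulVec]
  · rintro ⟨y, rfl⟩ i hi
    rw [Matrix.mulVec_mulVec, ← mul_assoc, unip_mul, neg_add_cancel, unip_zero, one_mul,
      pivotProj, Matrix.mulVec_diagonal, if_neg hi, zero_mul]

/-- The unipotent matrix of the Schubert cell, with constant entries, over `𝒪`. -/
def unipO {K : Type*} [Field K] (S : Finset (Fin 4)) (c : CellIndex S → K) :
    GL (Fin 4) K⟦X⟧ :=
  unipGL S fun p => PowerSeries.C (c p)

theorem unipO_map_constantCoeff {K : Type*} [Field K] (S : Finset (Fin 4)) (c : CellIndex S → K) :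
    (unipO S c : Matrix (Fin 4) (Fin 4) K⟦X⟧).map (PowerSeries.constantCoeff (R := K)) =
      unip S c := by
  change (unip S _).map _ = _
  rw [unip_map]
  simp

theorem eq_diagonal_X_mul {K : Type*} [Field K] {M : Matrix (Fin 4) (Fin 4) K⟦X⟧}
    (h : M.map (PowerSeries.constantCoeff (R := K)) = 0) :
    ∃ Z : Matrix (Fin 4) (Fin 4) K⟦X⟧, M = Matrix.diagonal (fun _ => PowerSeries.X) * Z := by
  have h1 : ∀ i j, ∃ s, M i j = PowerSeries.X * s := fun i j =>
    PowerSeries.X_dvd_iff.2 (congrFun (congrFun h i) j)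
  choose Z hZ using h1
  refine ⟨Matrix.of Z, ?_⟩
  ext1 i j
  rw [Matrix.diagonal_mul, hZ]
  rfl

/-- The lattice `A 𝒪⁴` contains `π 𝒪⁴` because `A B = π`, so it is determined by its image in `K⁴`.
Take `(S, c)` to be the cell of that image; then `A` and `u · pivotDiag` span the same lattice and
differ by an element of `GL(4, 𝒪)`. -/
theorem exists_cell_decomposition {K : Type*} [Field K] {A B : Matrix (Fin 4) (Fin 4) K⟦X⟧}
    (hAB : A * B = Matrix.diagonal fun _ => PowerSeries.X) :
    ∃ (S : Finset (Fin 4)) (c : CellIndex S → K) (w : GL (Fin 4) K⟦X⟧),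
      A = unipO S c * pivotDiag K S * w := by
  obtain ⟨S, c, hU⟩ := exists_inCell
    (LinearMap.range (A.map (PowerSeries.constantCoeff (R := K))).mulVecLin)
  have hU' : ∀ x, (∃ y, (A.map (PowerSeries.constantCoeff (R := K))).mulVec y = x) ↔
      InCell S c x := hU
  have hneg : ((unipO S c)⁻¹ : GL (Fin 4) K⟦X⟧) = unipO S (-c) := by
    ext1
    change unip S _ = unip S _
    congr 1
    ext1 p
    simp
  -- rows off `S` of `u⁻¹ A` are divisible by the uniformizer
  have hdiv : ∀ i j, ∃ s, ((unipO S c)⁻¹ * A : Matrix (Fin 4) (Fin 4) K⟦X⟧) i j =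
      (if i ∈ S then 1 else PowerSeries.X) * s := by
    intro i j
    split_ifs with hi
    · exact ⟨_, (one_mul _).symm⟩
    · refine PowerSeries.X_dvd_iff.2 ?_
      have h1 := (inCell_iff S c _).1 ((hU' _).1 ⟨Pi.single j 1, rfl⟩) i hi
      rw [Matrix.mulVec_mulVec, Matrix.mulVec_single_one] at h1
      rw [← h1, ← unipO_map_constantCoeff, ← Matrix.map_mul, ← hneg]
      rfl
  choose A' hA' using hdiv
  have hA1 : A = unipO S c * (pivotDiag K S * Matrix.of A') := by
    have : (((unipO S c)⁻¹ : GL (Fin 4) K⟦X⟧) : Matrix (Fin 4) (Fin 4) K⟦X⟧) * A =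
        pivotDiag K S * Matrix.of A' := by
      ext1 i j
      rw [pivotDiag, Matrix.diagonal_mul, Matrix.of_apply, ← hA']
    rw [← this, ← mul_assoc, Units.mul_inv, one_mul]
  -- the other divisibility
  have hcol : ∀ j, ∃ y, (A.map (PowerSeries.constantCoeff (R := K))).mulVec y =
      (unip S c * pivotProj K S).mulVec (Pi.single j 1) := fun j =>
    (hU' _).2 ((inCell_iff_range S c _).2 ⟨_, rfl⟩)
  choose Y hY using hcol
  obtain ⟨Z, hZ⟩ := eq_diagonal_X_mul (M := (unipO S c : Matrix (Fin 4) (Fin 4) K⟦X⟧) *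
    pivotDiag K S - A * (Matrix.of fun i j => Y j i).map (PowerSeries.C (R := K))) (by
      rw [Matrix.map_sub _ (map_sub _), Matrix.map_mul, Matrix.map_mul, unipO_map_constantCoeff,
        pivotDiag_map_constantCoeff, sub_eq_zero]
      ext1 i j
      have := congrFun (hY j) i
      rw [Matrix.mulVec_single_one] at this
      rw [show (unip S c * pivotProj K S) i j = (unip S c * pivotProj K S).col j i from rfl,
        ← this]
      simp [Matrix.mul_apply, Matrix.mulVec, dotProduct])
  -- Writing `π` as `A B` turns the error term divisible by `π` into a multiple of `A`.
  rw [← hAB, mul_assoc, sub_eq_iff_eq_add, ← mul_add] at hZ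
  set A'' := B * Z + (Matrix.of fun i j => Y j i).map (PowerSeries.C (R := K)) with hA''
  have h2 : pivotDiag K S * 1 = pivotDiag K S * (Matrix.of A' * A'') := by
    refine (unipO S c).isUnit.mul_left_cancel ?_
    rw [mul_one, hZ]
    conv_lhs => rw [hA1]
    simp only [mul_assoc]
  have h3 : (1 : Matrix (Fin 4) (Fin 4) K⟦X⟧) = Matrix.of A' * A'' := by
    ext1 i j
    have := congrFun (congrFun h2 i) j
    rw [pivotDiag, Matrix.diagonal_mul, Matrix.diagonal_mul] at this
    refine mul_left_cancel₀ ?_ this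
    split_ifs
    · exact one_ne_zero
    · exact PowerSeries.X_ne_zero
  exact ⟨S, c, ⟨Matrix.of A', A'', h3.symm, mul_eq_one_comm.1 h3.symm⟩, by
    rw [mul_assoc]; exact hA1⟩

/-- A representative of the lattice attached to a point of a Schubert cell. -/
def cellGL {K : Type*} [Field K] (S : Finset (Fin 4)) (c : CellIndex S → K) :
    GL (Fin 4) K⸨X⸩ :=
  intGL (unipO S c) * tDiag K (ind S)

/-- The integral representative is `t⁻¹` times `cellGL`. The homothety is invisible on vertices and
makes the colour rise by exactly `|S|`. -/
theorem cellGL_mul_tDiag {K : Type*} [Field K] (S : Finset (Fin 4)) (c : CellIndex S → K) :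
    ((cellGL S c * tDiag K fun _ => -1 : GL (Fin 4) K⸨X⸩) : Matrix (Fin 4) (Fin 4) K⸨X⸩) =
      (unipO S c * pivotDiag K S : Matrix (Fin 4) (Fin 4) K⟦X⟧).map (algebraMap K⟦X⟧ K⸨X⸩) := by
  rw [cellGL, mul_assoc, ← tDiag_add, Units.val_mul, ← pivotDiag_map_algebraMap, Matrix.map_mul]
  rfl

theorem vertexOf_eq_cell {K : Type*} [Field K] {k : GL (Fin 4) K⸨X⸩} (g : GL (Fin 4) K⸨X⸩)
    {S : Finset (Fin 4)} {c : CellIndex S → K} {w : GL (Fin 4) K⟦X⟧}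
    (hk : (k : Matrix (Fin 4) (Fin 4) K⸨X⸩) =
      (unipO S c * pivotDiag K S * w : Matrix (Fin 4) (Fin 4) K⟦X⟧).map
        (algebraMap K⟦X⟧ K⸨X⸩)) :
    vertexOf (g * k) = vertexOf (g * cellGL S c) := by
  have : k = cellGL S c * (tDiag K fun _ => -1) * intGL w := by
    ext1
    rw [hk, Units.val_mul, cellGL_mul_tDiag, Matrix.map_mul (M := (w : Matrix (Fin 4) (Fin 4) K⟦X⟧))]
    rfl
  rw [this, ← mul_assoc, vertexOf_mul_intGL, ← mul_assoc, vertexOf_mul_tDiag_const]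

theorem pivotDiag_mul_compl {K : Type*} [Field K] (S : Finset (Fin 4)) :
    pivotDiag K S * pivotDiag K Sᶜ = Matrix.diagonal fun _ => PowerSeries.X := by
  rw [pivotDiag, pivotDiag, Matrix.diagonal_mul_diagonal]
  congr 1
  ext1 i
  by_cases hi : i ∈ S <;> simp [hi]

theorem isUnit_pivotDiag_iff {K : Type*} [Field K] (S : Finset (Fin 4)) :
    IsUnit (pivotDiag K S) ↔ S = Finset.univ := by
  constructor
  · intro h
    rw [pivotDiag, Matrix.isUnit_diagonal, Pi.isUnit_iff] at h
    ext i
    by_contra hi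
    have := h i
    rw [if_neg (by simpa using hi), PowerSeries.isUnit_iff_constantCoeff] at this
    simp at this
  · rintro rfl
    simp [pivotDiag]

theorem adj_iff_cell {K : Type*} [Field K] {g : GL (Fin 4) K⸨X⸩} {y : Vertex K} :
    Adj (vertexOf g) y ↔ ∃ (S : Finset (Fin 4)) (c : CellIndex S → K),
      S ≠ ∅ ∧ S ≠ Finset.univ ∧ y = vertexOf (g * cellGL S c) := by
  rw [adj_iff]
  constructor
  · rintro ⟨k, A, B, hk, hAB, hA, hB, rfl⟩
    obtain ⟨S, c, w, rfl⟩ := exists_cell_decomposition hAB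
    rw [Units.isUnit_mul_units, Units.isUnit_units_mul, isUnit_pivotDiag_iff] at hA
    refine ⟨S, c, ?_, hA, vertexOf_eq_cell g hk⟩
    -- With no pivots `A` is `π` times a unit, so `A B = π` would make `B` a unit.
    rintro rfl
    refine hB ?_
    have h0 : pivotDiag K ∅ = Matrix.diagonal fun _ => PowerSeries.X := by simp [pivotDiag]
    have hc : (unipO ∅ c * pivotDiag K ∅ : Matrix (Fin 4) (Fin 4) K⟦X⟧) =
        pivotDiag K ∅ * unipO ∅ c := by
      rw [h0]
      exact (Matrix.scalar_commute _ (fun r => Commute.all _ _) _).symm.eq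
    rw [hc, mul_assoc, mul_assoc] at hAB
    have h1 : ((unipO ∅ c * w : GL (Fin 4) K⟦X⟧) : Matrix (Fin 4) (Fin 4) K⟦X⟧) * B = 1 := by
      rw [Units.val_mul, mul_assoc]
      ext1 i j
      have := congrFun (congrFun (hAB.trans (h0.symm.trans (mul_one _).symm)) i) j
      rw [h0, Matrix.diagonal_mul, Matrix.diagonal_mul] at this
      exact mul_left_cancel₀ PowerSeries.X_ne_zero this
    exact IsUnit.of_mul_eq_one _ (mul_eq_one_comm.1 h1)
  · rintro ⟨S, c, h0, h1, rfl⟩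
    refine ⟨cellGL S c * tDiag K fun _ => -1, unipO S c * pivotDiag K S,
      pivotDiag K Sᶜ * (unipO S c)⁻¹, cellGL_mul_tDiag S c, ?_, ?_, ?_, ?_⟩
    · have hc : Commute (Matrix.diagonal (fun _ => PowerSeries.X))
          (unipO S c : Matrix (Fin 4) (Fin 4) K⟦X⟧) :=
        Matrix.scalar_commute _ (fun r => Commute.all _ _) _
      rw [mul_assoc, ← mul_assoc (pivotDiag K S), pivotDiag_mul_compl, ← mul_assoc, ← hc.eq,
        mul_assoc, Units.mul_inv, mul_one]
    · rwa [Units.isUnit_units_mul, isUnit_pivotDiag_iff]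
    · rw [Units.isUnit_mul_units, isUnit_pivotDiag_iff]
      simpa using h0
    · rw [← mul_assoc, vertexOf_mul_tDiag_const]

theorem nonneg_of_map_mul_tDiag {K : Type*} [Field K] {A B : Matrix (Fin 4) (Fin 4) K⟦X⟧} {k : ℤ}
    (h : A.map (algebraMap K⟦X⟧ K⸨X⸩) * (tDiag K fun _ => k) = B.map (algebraMap K⟦X⟧ K⸨X⸩))
    (hB : B.map (PowerSeries.constantCoeff (R := K)) ≠ 0) : 0 ≤ k := by
  by_contra! hk
  obtain ⟨n, rfl⟩ : ∃ n : ℕ, k = -(n + 1 : ℕ) := ⟨(-k - 1).toNat, by omega⟩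
  have h1 : B = A * Matrix.diagonal fun _ => PowerSeries.X ^ (n + 1) := by
    refine map_algebraMap_injective ?_
    rw [← h, Matrix.map_mul, coe_tDiag, Matrix.diagonal_map (map_zero _)]
    congr 2
    ext1 _
    rw [map_pow, algebraMap_X_eq, ← zpow_natCast, ← zpow_mul]
    congr 1
    ring
  refine hB ?_
  rw [h1]
  ext1 i j
  simp

/-- Both integral representatives are nonzero modulo `π`, as the pivot sets are nonempty; this
forces the homothety to be trivial. Reducing modulo `π` then gives one subspace with two cell
descriptions. -/
theorem cellGL_injective {K : Type*} [Field K] (g : GL (Fin 4) K⸨X⸩) {S S' : Finset (Fin 4)}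
    {c : CellIndex S → K} {c' : CellIndex S' → K} (hS : S ≠ ∅) (hS' : S' ≠ ∅)
    (h : vertexOf (g * cellGL S c) = vertexOf (g * cellGL S' c')) :
    (⟨S, c⟩ : (S : Finset (Fin 4)) × (CellIndex S → K)) = ⟨S', c'⟩ := by
  obtain ⟨w, k, hw⟩ := vertexOf_eq_iff.1 h
  rw [mul_assoc, mul_assoc, mul_left_cancel_iff, ← mul_assoc] at hw
  have hproj : ∀ T : Finset (Fin 4), T ≠ ∅ → pivotProj K T ≠ 0 := by
    intro T hT h0
    obtain ⟨i, hi⟩ := Finset.nonempty_iff_ne_empty.2 hT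
    have := congrFun (congrFun h0 i) i
    simp [pivotProj, hi] at this
  have hw' : cellGL S' c' * (tDiag K fun _ => -1) =
      (cellGL S c * tDiag K fun _ => -1) * intGL w * tDiag K fun _ => k := by
    rw [hw, mul_assoc _ _ (tDiag K _), mul_assoc _ _ (tDiag K _), ← tDiag_const_comm (-1),
      mul_assoc, mul_assoc, ← mul_assoc (tDiag K _) (intGL w), tDiag_const_comm (-1) (intGL w)]
    simp only [mul_assoc]
  set M : Matrix (Fin 4) (Fin 4) K⟦X⟧ := unipO S c * pivotDiag K S * w with hM
  set M' : Matrix (Fin 4) (Fin 4) K⟦X⟧ := unipO S' c' * pivotDiag K S' with hM'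
  have e1 : M.map (algebraMap K⟦X⟧ K⸨X⸩) * (tDiag K fun _ => k) =
      M'.map (algebraMap K⟦X⟧ K⸨X⸩) := by
    have := congrArg Units.val hw'
    rw [cellGL_mul_tDiag, Units.val_mul, Units.val_mul, cellGL_mul_tDiag] at this
    rw [hM', this, hM, Matrix.map_mul (M := (w : Matrix (Fin 4) (Fin 4) K⟦X⟧))]
    rfl
  have e2 : M'.map (algebraMap K⟦X⟧ K⸨X⸩) * (tDiag K fun _ => -k) =
      M.map (algebraMap K⟦X⟧ K⸨X⸩) := by
    rw [← e1, mul_assoc, ← Units.val_mul, ← tDiag_add]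
    have : ((fun _ => k) + fun _ => -k : Fin 4 → ℤ) = 0 := by
      ext
      simp
    rw [this, tDiag_zero, Units.val_one, mul_one]
  have hMc : M.map (PowerSeries.constantCoeff (R := K)) =
      unip S c * pivotProj K S *
        (Matrix.GeneralLinearGroup.map (PowerSeries.constantCoeff (R := K)) w : GL (Fin 4) K) := by
    rw [hM, Matrix.map_mul, Matrix.map_mul, unipO_map_constantCoeff, pivotDiag_map_constantCoeff]
    rfl
  have hMc' : M'.map (PowerSeries.constantCoeff (R := K)) = unip S' c' * pivotProj K S' := by
    rw [hM', Matrix.map_mul, unipO_map_constantCoeff, pivotDiag_map_constantCoeff]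
  have hu : ∀ (T : Finset (Fin 4)) (d : CellIndex T → K), T ≠ ∅ →
      unip T d * pivotProj K T ≠ 0 := by
    intro T d hT h0
    refine hproj T hT ((unipGL T d).isUnit.mul_left_cancel ?_)
    rw [mul_zero]
    exact h0
  have hk1 := nonneg_of_map_mul_tDiag e1 (by rw [hMc']; exact hu S' c' hS')
  have hk2 := nonneg_of_map_mul_tDiag e2 (by
    rw [hMc]
    intro h0
    exact hu S c hS ((Matrix.GeneralLinearGroup.map (PowerSeries.constantCoeff (R := K))
      w).isUnit.mul_right_cancel (h0.trans (zero_mul _).symm)))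
  obtain rfl : k = 0 := by omega
  have hMM : M = M' := map_algebraMap_injective (by
    rw [← e1, show (fun _ : Fin 4 => (0 : ℤ)) = 0 from rfl, tDiag_zero, Units.val_one, mul_one])
  rw [hMM, hMc'] at hMc
  refine inCell_unique fun x => ?_
  rw [inCell_iff_range, inCell_iff_range, hMc]
  set w' := Matrix.GeneralLinearGroup.map (n := Fin 4) (PowerSeries.constantCoeff (R := K)) w
  constructor
  · rintro ⟨y, rfl⟩
    refine ⟨((w'⁻¹ : GL (Fin 4) K) : Matrix (Fin 4) (Fin 4) K).mulVec y, ?_⟩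
    rw [Matrix.mulVec_mulVec, mul_assoc, Units.mul_inv, mul_one]
  · rintro ⟨y, rfl⟩
    exact ⟨(w' : Matrix (Fin 4) (Fin 4) K).mulVec y, by rw [Matrix.mulVec_mulVec]⟩

theorem color_cell {K : Type*} [Field K] (g : GL (Fin 4) K⸨X⸩) (S : Finset (Fin 4))
    (c : CellIndex S → K) :
    color (vertexOf (g * cellGL S c)) = color (vertexOf g) + (S.card : ZMod 4) := by
  have : ∑ i, ind S i = (S.card : ℤ) := by simp [ind]
  rw [color_vertexOf_mul, cellGL, color_vertexOf_mul, color_intGL, color_tDiag, zero_add, this,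
    Int.cast_natCast]

/-- The neighbours of `x` whose colour exceeds that of `x` by `i`. -/
def nbrs {K : Type*} [Field K] (i : ZMod 4) (x : Vertex K) : Set (Vertex K) :=
  {y | Adj x y ∧ color y = color x + i}

theorem sum_nbrs {K : Type*} [Field K] [Fintype K] (g : GL (Fin 4) K⸨X⸩) {i : ℕ} (h0 : 0 < i)
    (h4 : i < 4) (f : Vertex K → ℂ) :
    (nbrs (i : ZMod 4) (vertexOf g)).Finite ∧ ∑ᶠ y ∈ nbrs (i : ZMod 4) (vertexOf g), f y =
      ∑ S ∈ Finset.powersetCard i Finset.univ, ∑ c : CellIndex S → K,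
        f (vertexOf (g * cellGL S c)) := by
  classical
  let s : Finset ((S : Finset (Fin 4)) × (CellIndex S → K)) :=
    (Finset.powersetCard i Finset.univ).sigma fun _ => Finset.univ
  have hs : ∀ p, p ∈ s ↔ p.1.card = i := by
    intro p
    simp [s, Finset.mem_powersetCard]
  have hne : ∀ p ∈ s, p.1 ≠ ∅ := by
    intro p hp h
    rw [hs, h, Finset.card_empty] at hp
    omega
  have himg : nbrs (i : ZMod 4) (vertexOf g) =
      (s.image fun p => vertexOf (g * cellGL p.1 p.2) : Finset (Vertex K)) := by
    ext y
    rw [Finset.coe_image, Set.mem_image]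
    constructor
    · rintro ⟨ha, hc⟩
      obtain ⟨S, c, hS0, hS1, rfl⟩ := adj_iff_cell.1 ha
      rw [color_cell, add_right_inj, ZMod.natCast_eq_natCast_iff'] at hc
      refine ⟨⟨S, c⟩, ?_, rfl⟩
      rw [Finset.mem_coe, hs]
      have hlt : S.card < 4 := by
        have := (Finset.card_lt_iff_ne_univ S).2 hS1
        simpa using this
      rwa [Nat.mod_eq_of_lt hlt, Nat.mod_eq_of_lt h4] at hc
    · rintro ⟨⟨S, c⟩, hp, rfl⟩
      have hcard := (hs _).1 hp
      refine ⟨adj_iff_cell.2 ⟨S, c, hne _ hp, ?_, rfl⟩, ?_⟩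
      · rintro rfl
        simp at hcard
        omega
      · rw [color_cell, hcard]
  refine ⟨himg ▸ Finset.finite_toSet _, ?_⟩
  rw [himg, finsum_mem_coe_finset, Finset.sum_image, Finset.sum_sigma]
  intro p hp p' hp' h
  exact cellGL_injective g (hne p hp) (hne p' hp') h

/-! ### The quotient `Γ \ G / W`: every orbit is represented by a unique dominant weight -/

/-- The permutation matrix as an invertible matrix. -/
def permGL (R : Type*) [CommRing R] (σ : Equiv.Perm (Fin 4)) : GL (Fin 4) R where
  val := σ.permMatrix R
  inv := σ⁻¹.permMatrix R
  val_inv := by rw [← Matrix.permMatrix_mul, inv_mul_cancel, Matrix.permMatrix_one]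
  inv_val := by rw [← Matrix.permMatrix_mul, mul_inv_cancel, Matrix.permMatrix_one]

theorem map_permGL {R R' : Type*} [CommRing R] [CommRing R'] (f : R →+* R')
    (σ : Equiv.Perm (Fin 4)) :
    Matrix.GeneralLinearGroup.map f (permGL R σ) = permGL R' σ := by
  ext i j
  rw [Matrix.GeneralLinearGroup.map_apply]
  change f (σ.permMatrix R i j) = σ.permMatrix R' i j
  simp only [Equiv.Perm.permMatrix, PEquiv.toMatrix_apply]
  split_ifs <;> simp

theorem permGL_mul_tDiag {K : Type*} [Field K] (σ : Equiv.Perm (Fin 4)) (μ : Fin 4 → ℤ) :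
    permGL K⸨X⸩ σ * tDiag K μ = tDiag K (μ ∘ σ) * permGL K⸨X⸩ σ := by
  ext1
  ext1 i j
  rw [Units.val_mul, Units.val_mul, coe_tDiag, coe_tDiag, Matrix.mul_diagonal,
    Matrix.diagonal_mul]
  change σ.permMatrix K⸨X⸩ i j * _ = _ * σ.permMatrix K⸨X⸩ i j
  simp only [Equiv.Perm.permMatrix, PEquiv.toMatrix_apply, Equiv.toPEquiv_apply, Option.mem_some_iff,
    Function.comp_apply]
  split_ifs with h
  · rw [h, one_mul, mul_one]
  · rw [zero_mul, mul_zero]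

/-- Permutation matrices belong to both `Γ` and `W`. -/
theorem toQ_tDiag_comp_perm {K : Type*} [Field K] (σ : Equiv.Perm (Fin 4)) (μ : Fin 4 → ℤ) :
    toQ (vertexOf (tDiag K (μ ∘ σ))) = toQ (vertexOf (tDiag K μ)) := by
  rw [← vertexOf_mul_intGL _ (permGL K⟦X⟧ σ), map_permGL, ← permGL_mul_tDiag,
    ← map_permGL (polyEmb K) σ, toQ_polyGL_mul]

theorem exists_antitone_toQ {K : Type*} [Field K] (μ : Fin 4 → ℤ) :
    ∃ ν : Fin 4 → ℤ, Antitone ν ∧ toQ (vertexOf (tDiag K μ)) = toQ (vertexOf (tDiag K ν)) := by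
  refine ⟨μ ∘ (Fin.revPerm.trans (Tuple.sort μ)), ?_, (toQ_tDiag_comp_perm _ μ).symm⟩
  intro i j hij
  exact Tuple.monotone_sort μ (Fin.rev_le_rev.2 hij)

theorem toQ_cell {K : Type*} [Field K] {μ : Fin 4 → ℤ} (hμ : Antitone μ) (S : Finset (Fin 4))
    (c : CellIndex S → K) :
    toQ (vertexOf (tDiag K μ * cellGL S c)) = toQ (vertexOf (tDiag K (μ + ind S))) := by
  -- This is `t^μ u t^(-μ)`. Free positions have `p.1.1 < p.1.2`, so the exponent is nonnegative and
  -- `toNat` loses nothing.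
  let P : GL (Fin 4) (Polynomial K) := unipGL S fun p =>
    Polynomial.C (c p) * Polynomial.X ^ (μ p.1.1 - μ p.1.2).toNat
  have h : tDiag K μ * intGL (unipO S c) = polyGL P * tDiag K μ := by
    ext1
    ext1 i j
    rw [Units.val_mul, Units.val_mul, coe_tDiag, Matrix.diagonal_mul, Matrix.mul_diagonal,
      coe_intGL, coe_polyGL]
    change tElt K ^ μ i * (unip S _).map _ i j = (unip S _).map _ i j * tElt K ^ μ j
    rw [unip_map, unip_map]
    by_cases hij : i = j
    · subst hij
      rw [mul_comm]
      simp only [unip, Matrix.add_apply, cellNil_eq_zero_of_le _ le_rfl]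
    · simp only [unip, Matrix.add_apply, Matrix.one_apply_ne hij, zero_add, cellNil,
        Matrix.of_apply]
      split_ifs with hc
      · have hle := hμ hc.1.le
        have ht : polyEmb K Polynomial.X = tElt K := by
          simp [polyEmb]
        have hC : polyEmb K (Polynomial.C (c ⟨(i, j), hc⟩)) = HahnSeries.C (c ⟨(i, j), hc⟩) := by
          simp [polyEmb]
        rw [algebraMap_C_eq, map_mul, map_pow, ht, hC, ← zpow_natCast, mul_assoc,
          ← zpow_add₀ (tElt_ne_zero K), mul_comm]
        congr 2
        omega
      · rw [mul_zero, zero_mul]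
  rw [cellGL, ← mul_assoc, h, mul_assoc, toQ_polyGL_mul, tDiag_add]

/-- Right multiplication does not descend to orbits; changing the representative costs an integral
matrix in the middle. -/
theorem toQ_mul_congr {K : Type*} [Field K] {g h : GL (Fin 4) K⸨X⸩}
    (hgh : toQ (vertexOf g) = toQ (vertexOf h)) :
    ∃ w : GL (Fin 4) K⟦X⟧, ∀ x : GL (Fin 4) K⸨X⸩,
      toQ (vertexOf (h * x)) = toQ (vertexOf (g * (intGL w * x))) := by
  obtain ⟨P, w, k, rfl⟩ := toQ_vertexOf_eq_iff.1 hgh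
  refine ⟨w, fun x => ?_⟩
  rw [mul_assoc _ (tDiag K _), tDiag_const_comm, ← mul_assoc, vertexOf_mul_tDiag_const, mul_assoc,
    mul_assoc, toQ_polyGL_mul]

/-- The orbit of the vertex of `g` contains the vertex of a diagonal matrix. -/
def Reducible {K : Type*} [Field K] (g : GL (Fin 4) K⸨X⸩) : Prop :=
  ∃ μ : Fin 4 → ℤ, toQ (vertexOf g) = toQ (vertexOf (tDiag K μ))

theorem Reducible.mul_intGL {K : Type*} [Field K] {g : GL (Fin 4) K⸨X⸩} (h : Reducible g)
    (w : GL (Fin 4) K⟦X⟧) : Reducible (g * intGL w) := by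
  rwa [Reducible, vertexOf_mul_intGL]

theorem Reducible.mul_const {K : Type*} [Field K] {g : GL (Fin 4) K⸨X⸩} (h : Reducible g)
    (k : ℤ) : Reducible (g * tDiag K fun _ => k) := by
  rwa [Reducible, vertexOf_mul_tDiag_const]

/-- Replace `g` by `t^μ w` with `μ` antitone and `w` integral. The cell decomposition rewrites `w
t^(ind S)` as `u t^(ind T)` up to `W` and homothety, and `u` then moves into `Γ`. -/
theorem Reducible.mul_ind {K : Type*} [Field K] {g : GL (Fin 4) K⸨X⸩} (h : Reducible g)
    (S : Finset (Fin 4)) : Reducible (g * tDiag K (ind S)) := by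
  obtain ⟨μ', hμ'⟩ := h
  obtain ⟨μ, hμ, hμμ⟩ := exists_antitone_toQ (K := K) μ'
  obtain ⟨w, hw⟩ := toQ_mul_congr (hμ'.trans hμμ).symm
  obtain ⟨T, c, w', hA⟩ := exists_cell_decomposition
    (A := (w : Matrix (Fin 4) (Fin 4) K⟦X⟧) * pivotDiag K S)
    (B := pivotDiag K Sᶜ * (w⁻¹ : GL (Fin 4) K⟦X⟧)) (by
      have hc : Commute (Matrix.diagonal (fun _ => PowerSeries.X))
          (w : Matrix (Fin 4) (Fin 4) K⟦X⟧) :=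
        Matrix.scalar_commute _ (fun r => Commute.all _ _) _
      rw [mul_assoc, ← mul_assoc (pivotDiag K S), pivotDiag_mul_compl, ← mul_assoc, ← hc.eq,
        mul_assoc, Units.mul_inv, mul_one])
  have h1 := vertexOf_eq_cell (k := intGL w * tDiag K (ind S + fun _ => -1)) (tDiag K μ)
    (S := T) (c := c) (w := w') (by
      rw [← hA, Units.val_mul, ← pivotDiag_map_algebraMap, Matrix.map_mul]
      rfl)
  refine ⟨μ + ind T, ?_⟩
  rw [hw, ← toQ_cell hμ T c, ← h1, tDiag_add, ← mul_assoc, ← mul_assoc, ← mul_assoc,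
    vertexOf_mul_tDiag_const]

theorem Reducible.mul_single {K : Type*} [Field K] {g : GL (Fin 4) K⸨X⸩} (h : Reducible g)
    (i : Fin 4) (a : ℤ) : Reducible (g * tDiag K (Pi.single i a)) := by
  induction a using Int.induction_on with
  | zero => rwa [Pi.single_zero, tDiag_zero, mul_one]
  | succ n ih =>
    have : (Pi.single i ((n : ℤ) + 1) : Fin 4 → ℤ) = Pi.single i (n : ℤ) + ind {i} := by
      ext j
      by_cases hj : j = i <;> simp [hj, ind]
    rw [this, tDiag_add, ← mul_assoc]
    exact ih.mul_ind _
  | pred n ih =>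
    -- Lowering one entry is raising the three others and applying a homothety.
    have : (Pi.single i (-(n : ℤ) - 1) : Fin 4 → ℤ) =
        Pi.single i (-(n : ℤ)) + ind {i}ᶜ + fun _ => -1 := by
      ext j
      by_cases hj : j = i <;> simp [hj, ind, sub_eq_add_neg]
    rw [this, tDiag_add, tDiag_add, ← mul_assoc, ← mul_assoc]
    exact (ih.mul_ind _).mul_const _

theorem Reducible.mul_tDiag {K : Type*} [Field K] {g : GL (Fin 4) K⸨X⸩} (h : Reducible g)
    (μ : Fin 4 → ℤ) : Reducible (g * tDiag K μ) := by
  have : μ = Pi.single 0 (μ 0) + Pi.single 1 (μ 1) + Pi.single 2 (μ 2) + Pi.single 3 (μ 3) := by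
    ext j
    fin_cases j <;> simp
  rw [this, tDiag_add, tDiag_add, tDiag_add, ← mul_assoc, ← mul_assoc, ← mul_assoc]
  exact (((h.mul_single _ _).mul_single _ _).mul_single _ _).mul_single _ _

theorem transvection_map {R R' : Type*} [CommRing R] [CommRing R'] (f : R →+* R') (i j : Fin 4)
    (a : R) : (Matrix.transvection i j a).map f = Matrix.transvection i j (f a) := by
  ext x y
  simp only [Matrix.transvection, Matrix.map_apply, Matrix.add_apply, Matrix.one_apply,
    Matrix.single_apply, map_add]
  split_ifs <;> simp

/-- Transvections and diagonal matrices generate `GL(4, F)`. A transvection with entry `p t^k` is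
the integral one with entry `p` conjugated by the power `t^k` in slot `i`. -/
theorem Reducible.mul {K : Type*} [Field K] {g : GL (Fin 4) K⸨X⸩} (h : Reducible g)
    (x : GL (Fin 4) K⸨X⸩) : Reducible (g * x) := by
  have key : ∀ M : Matrix (Fin 4) (Fin 4) K⸨X⸩, M.det ≠ 0 → ∀ (y : GL (Fin 4) K⸨X⸩),
      (y : Matrix (Fin 4) (Fin 4) K⸨X⸩) = M → ∀ g : GL (Fin 4) K⸨X⸩, Reducible g →
        Reducible (g * y) := by
    intro M hM
    refine Matrix.diagonal_transvection_induction_of_det_ne_zero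
      (fun M => ∀ (y : GL (Fin 4) K⸨X⸩), (y : Matrix (Fin 4) (Fin 4) K⸨X⸩) = M →
        ∀ g : GL (Fin 4) K⸨X⸩, Reducible g → Reducible (g * y)) M hM ?_ ?_ ?_
    · intro D hD y hy g hg
      have hD0 : ∀ i, D i ≠ 0 := by
        rw [Matrix.det_diagonal, Finset.prod_ne_zero_iff] at hD
        exact fun i => hD i (Finset.mem_univ i)
      choose p k hp using fun i => exists_unit_mul_zpow (hD0 i)
      let w : GL (Fin 4) K⟦X⟧ :=
        ⟨Matrix.diagonal fun i => (p i : K⟦X⟧), Matrix.diagonal fun i => ((p i)⁻¹ : K⟦X⟧ˣ),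
          by simp [Matrix.diagonal_mul_diagonal], by simp [Matrix.diagonal_mul_diagonal]⟩
      have hw : y = intGL w * tDiag K k := by
        ext1
        rw [hy, Units.val_mul, coe_tDiag, coe_intGL]
        change _ = (Matrix.diagonal _).map _ * _
        rw [Matrix.diagonal_map (map_zero _), Matrix.diagonal_mul_diagonal]
        congr 1
        ext1 i
        exact hp i
      rw [hw, ← mul_assoc]
      exact (hg.mul_intGL _).mul_tDiag _
    · intro t y hy g hg
      obtain ⟨i, j, hij, c⟩ := t
      change (y : Matrix (Fin 4) (Fin 4) K⸨X⸩) = Matrix.transvection i j c at hy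
      by_cases hc : c = 0
      · have : y = 1 := by
          ext1
          rw [hy, hc, Matrix.transvection_zero, Units.val_one]
        rwa [this, mul_one]
      obtain ⟨p, k, hp⟩ := exists_unit_mul_zpow hc
      let w : GL (Fin 4) K⟦X⟧ :=
        ⟨Matrix.transvection i j (p : K⟦X⟧), Matrix.transvection i j (-(p : K⟦X⟧)),
          by rw [Matrix.transvection_mul_transvection_same _ _ hij, add_neg_cancel,
            Matrix.transvection_zero],
          by rw [Matrix.transvection_mul_transvection_same _ _ hij, neg_add_cancel,
            Matrix.transvection_zero]⟩
      have hw : y * tDiag K (Pi.single i k) = tDiag K (Pi.single i k) * intGL w := by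
        ext1
        ext1 a b
        rw [Units.val_mul, Units.val_mul, hy, coe_tDiag, coe_intGL, Matrix.mul_diagonal,
          Matrix.diagonal_mul]
        change _ = _ * (Matrix.transvection i j (p : K⟦X⟧)).map _ a b
        rw [transvection_map]
        simp only [Matrix.transvection, Matrix.add_apply]
        by_cases hab : a = b
        · subst hab
          rw [mul_comm]
          congr 2
          by_cases hia : i = a
          · subst hia
            simp [hij.symm]
          · simp [hia]
        · rw [Matrix.one_apply_ne hab, zero_add, zero_add, Matrix.single_apply,
            Matrix.single_apply]
          split_ifs with h
          · obtain ⟨rfl, rfl⟩ := h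
            rw [hp, Pi.single_eq_same, Pi.single_eq_of_ne hij.symm, zpow_zero, mul_one, mul_comm]
          · rw [zero_mul, mul_zero]
      have hy' : y = tDiag K (Pi.single i k) * intGL w * tDiag K (-Pi.single i k) := by
        rw [← hw, mul_assoc, ← tDiag_add, add_neg_cancel, tDiag_zero, mul_one]
      rw [hy', ← mul_assoc, ← mul_assoc]
      exact ((hg.mul_tDiag _).mul_intGL _).mul_tDiag _
    · intro A B hA hB ihA ihB y hy g hg
      have hyAB : y = Matrix.GeneralLinearGroup.mkOfDetNeZero A hA *
          Matrix.GeneralLinearGroup.mkOfDetNeZero B hB := by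
        ext1
        exact hy
      rw [hyAB, ← mul_assoc]
      exact ihB _ rfl _ (ihA _ rfl _ hg)
  exact key _ (Matrix.GeneralLinearGroup.det_ne_zero x) x rfl g h

theorem exists_antitone_eq_toQ {K : Type*} [Field K] (u : QVertex K) :
    ∃ μ : Fin 4 → ℤ, Antitone μ ∧ u = toQ (vertexOf (tDiag K μ)) := by
  induction u using Quotient.inductionOn' with
  | h x =>
    obtain ⟨g, rfl⟩ := vertexOf_surjective x
    have h1 : Reducible (1 : GL (Fin 4) K⸨X⸩) := ⟨0, by rw [tDiag_zero]⟩
    obtain ⟨μ, hμ⟩ := h1.mul g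
    obtain ⟨ν, hν, hμν⟩ := exists_antitone_toQ (K := K) μ
    rw [one_mul] at hμ
    exact ⟨ν, hν, hμ.trans hμν⟩

/-- The zero block has `4 - i` rows and `i + 1` columns, five in all, so by pigeonhole every
permutation meets it. -/
theorem det_eq_zero_of_block {R : Type*} [CommRing R] {M : Matrix (Fin 4) (Fin 4) R} {i : Fin 4}
    (h : ∀ a b, b ≤ i → i ≤ a → M a b = 0) : M.det = 0 := by
  have hperm : ∀ (i : Fin 4) (σ : Equiv.Perm (Fin 4)), ∃ b, b ≤ i ∧ i ≤ σ b := by decide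
  rw [Matrix.det_apply]
  refine Finset.sum_eq_zero fun σ _ => ?_
  obtain ⟨b, hb, hσ⟩ := hperm i σ
  rw [Finset.prod_eq_zero (f := fun i => M (σ i) i) (Finset.mem_univ b) (h _ _ hb hσ), smul_zero]

/-- Solving for `P` gives `t^ν w⁻¹ t^(-μ-k)`, so its entry `(i, j)` has degree at most `ν i - μ j -
k`. -/
theorem coeff_eq_zero_of_orbit {K : Type*} [Field K] {μ ν : Fin 4 → ℤ}
    {P : GL (Fin 4) (Polynomial K)} {w : GL (Fin 4) K⟦X⟧} {k : ℤ}
    (h : tDiag K ν = polyGL P * tDiag K μ * intGL w * tDiag K fun _ => k) (i j : Fin 4) {n : ℕ}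
    (hn : ν i < n + (μ j + k)) :
    ((P : Matrix (Fin 4) (Fin 4) (Polynomial K)) i j).coeff n = 0 := by
  have h1 : polyGL P * tDiag K (μ + fun _ => k) = tDiag K ν * intGL w⁻¹ := by
    rw [h, map_inv, eq_mul_inv_iff_mul_eq, tDiag_add, mul_assoc, mul_assoc, mul_assoc, mul_assoc,
      tDiag_const_comm]
  have h2 : ((polyGL P * tDiag K (μ + fun _ => k) : GL (Fin 4) K⸨X⸩) :
      Matrix (Fin 4) (Fin 4) K⸨X⸩) i j = ((tDiag K ν * intGL w⁻¹ : GL (Fin 4) K⸨X⸩) :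
      Matrix (Fin 4) (Fin 4) K⸨X⸩) i j := by rw [h1]
  rw [Units.val_mul, Units.val_mul, coe_tDiag, coe_tDiag, Matrix.mul_diagonal,
    Matrix.diagonal_mul, coe_polyGL, coe_intGL, Matrix.map_apply, Matrix.map_apply] at h2
  refine coeff_eq_zero_of_polyEmb_mul_zpow (k := μ j + k - ν i)
    (s := (w⁻¹ : GL (Fin 4) K⟦X⟧) i j) ?_ (by omega)
  rw [zpow_sub₀ (tElt_ne_zero K), ← mul_div_assoc, div_eq_iff (zpow_ne_zero _ (tElt_ne_zero K)),
    mul_comm (algebraMap _ _ _)]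
  exact h2

/-- If `ν i < μ i + k`, the degree bound is negative for all rows from `i` on and all columns up to
`i`, and `P` would be singular. -/
theorem le_of_orbit {K : Type*} [Field K] {μ ν : Fin 4 → ℤ} (hμ : Antitone μ) (hν : Antitone ν)
    {P : GL (Fin 4) (Polynomial K)} {w : GL (Fin 4) K⟦X⟧} {k : ℤ}
    (h : tDiag K ν = polyGL P * tDiag K μ * intGL w * tDiag K fun _ => k) (i : Fin 4) :
    μ i + k ≤ ν i := by
  by_contra! hi
  refine Matrix.GeneralLinearGroup.det_ne_zero P (det_eq_zero_of_block (i := i) fun a b hb ha => ?_)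
  ext n
  rw [coeff_eq_zero_of_orbit h a b, Polynomial.coeff_zero]
  have := hμ hb
  have := hν ha
  omega

theorem eq_add_of_orbit {K : Type*} [Field K] {μ ν : Fin 4 → ℤ} (hμ : Antitone μ)
    (hν : Antitone ν) {P : GL (Fin 4) (Polynomial K)} {w : GL (Fin 4) K⟦X⟧} {k : ℤ}
    (h : tDiag K ν = polyGL P * tDiag K μ * intGL w * tDiag K fun _ => k) :
    ν = μ + fun _ => k := by
  have h' : tDiag K μ = polyGL P⁻¹ * tDiag K ν * intGL w⁻¹ * tDiag K fun _ => -k := by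
    have hk : (tDiag K fun _ => -k) = (tDiag K fun _ => k)⁻¹ := tDiag_neg _
    rw [hk, eq_mul_inv_iff_mul_eq, map_inv, map_inv, eq_mul_inv_iff_mul_eq, mul_assoc,
      tDiag_const_comm, eq_inv_mul_iff_mul_eq, h]
    simp only [mul_assoc]
  ext i
  have h1 := le_of_orbit hμ hν h i
  have h2 := le_of_orbit hν hμ h' i
  rw [Pi.add_apply]
  omega

theorem toQ_tDiag_eq {K : Type*} [Field K] {μ ν : Fin 4 → ℤ} (hμ : Antitone μ)
    (hν : Antitone ν) (h : toQ (vertexOf (tDiag K μ)) = toQ (vertexOf (tDiag K ν))) :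
    ∃ k : ℤ, ν = μ + fun _ => k := by
  obtain ⟨P, w, k, hP⟩ := toQ_vertexOf_eq_iff.1 h
  exact ⟨k, eq_add_of_orbit hμ hν hP⟩

/-- A stabilizing polynomial matrix has entries of degree at most `μ i - μ j`, and `K` is finite. -/
theorem finite_stabilizer {K : Type*} [Field K] [Finite K] {μ : Fin 4 → ℤ} (hμ : Antitone μ) :
    Finite (MulAction.stabilizer (Gam K) (vertexOf (tDiag K μ))) := by
  obtain ⟨N, hN⟩ : ∃ N : ℕ, ∀ i j, μ i - μ j ≤ N :=
    ⟨(μ 0 - μ 3).toNat, fun i j => by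
      have := hμ (Fin.zero_le i)
      have := hμ (Fin.le_last j)
      have h3 : μ (Fin.last 3) = μ 3 := rfl
      omega⟩
  have hfin : {M : Matrix (Fin 4) (Fin 4) (Polynomial K) |
      ∀ i j, M i j ∈ Polynomial.degreeLT K (N + 1)}.Finite := by
    have : Finite (Polynomial.degreeLT K (N + 1)) :=
      Finite.of_equiv _ (Polynomial.degreeLTEquiv K (N + 1)).symm.toEquiv
    have h1 : {p : Polynomial K | p ∈ Polynomial.degreeLT K (N + 1)}.Finite := this
    exact Set.Finite.pi' fun i => Set.Finite.pi' fun j => h1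
  have hfin' := (hfin.preimage (Units.val_injective.injOn (s := Set.univ) |>.mono
    (Set.subset_univ _))).image (gamOf (K := K))
  refine (hfin'.subset ?_ : (MulAction.stabilizer (Gam K) (vertexOf (tDiag K μ)) :
    Set (Gam K)).Finite)
  intro γ hγ
  obtain ⟨P, rfl⟩ := gamOf_surjective γ
  refine ⟨P, fun i j => ?_, rfl⟩
  have h1 : vertexOf (polyGL P * tDiag K μ) = vertexOf (tDiag K μ) := hγ
  obtain ⟨w, k, hk⟩ := vertexOf_eq_iff.1 h1
  have h2 := congrFun (eq_add_of_orbit hμ hμ hk) 0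
  obtain rfl : k = 0 := by
    rw [Pi.add_apply] at h2
    omega
  rw [Polynomial.mem_degreeLT, Polynomial.degree_lt_iff_coeff_zero]
  intro n hn
  refine coeff_eq_zero_of_orbit hk i j ?_
  have := hN i j
  omega

/-! ### The weighted adjacency operator as a sum over neighbours in the building -/

theorem smul_mem_nbrs {K : Type*} [Field K] {i : ZMod 4} {x y : Vertex K} (γ : Gam K)
    (h : y ∈ nbrs i x) : γ • y ∈ nbrs i (γ • x) := by
  obtain ⟨P, rfl⟩ := gamOf_surjective γ
  obtain ⟨g, rfl⟩ := vertexOf_surjective x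
  obtain ⟨hadj, hc⟩ := h
  obtain ⟨S, c, h0, h1, rfl⟩ := adj_iff_cell.1 hadj
  rw [color_cell, add_right_inj] at hc
  rw [gamOf_smul_vertexOf, gamOf_smul_vertexOf, ← mul_assoc]
  exact ⟨adj_iff_cell.2 ⟨S, c, h0, h1, rfl⟩, by rw [color_cell, hc]⟩

theorem toQPair_eq_iff {K : Type*} [Field K] {x y x' y' : Vertex K} :
    toQPair x y = toQPair x' y' ↔ ∃ γ : Gam K, γ • x' = x ∧ γ • y' = y := by
  unfold toQPair
  rw [Quotient.eq'']
  exact exists_congr fun γ => Prod.ext_iff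

theorem outEdges_eq_image {K : Type*} [Field K] (i : ZMod 4) (x : Vertex K) :
    outEdges i (toQ x) = toQPair x '' nbrs i x := by
  ext e
  constructor
  · rintro ⟨x', y', hadj, hc, hx, rfl⟩
    obtain ⟨γ, hγ⟩ := toQ_eq_iff.1 hx.symm
    refine ⟨γ • y', hγ ▸ smul_mem_nbrs γ ⟨hadj, hc⟩, toQPair_eq_iff.2 ⟨γ, hγ, rfl⟩⟩
  · rintro ⟨y, ⟨hadj, hc⟩, rfl⟩
    exact ⟨x, y, hadj, hc, rfl, rfl⟩

theorem card_orbit_stabilizer {H X Y : Type*} [Group H] [MulAction H X] [MulAction H Y] (x : X)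
    (y : Y) :
    Nat.card (MulAction.stabilizer H x) =
      Nat.card (MulAction.orbit (MulAction.stabilizer H x) y) *
        Nat.card (MulAction.stabilizer H (x, y)) := by
  have e : MulAction.stabilizer (MulAction.stabilizer H x) y ≃ MulAction.stabilizer H (x, y) :=
    { toFun := fun g => ⟨g.1.1, Prod.ext g.1.2 g.2⟩
      invFun := fun g => ⟨⟨g.1, congrArg Prod.fst g.2⟩, congrArg Prod.snd g.2⟩
      left_inv := fun _ => rfl
      right_inv := fun _ => rfl }
  rw [← Nat.card_congr e, Nat.card_congr (MulAction.orbitEquivQuotientStabilizer _ y)]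
  exact Subgroup.card_eq_card_quotient_mul_card_subgroup _

/-- For `e = (x, y)` the ratio `w(e)/w(u) = |Γ_x|/|Γ_e|` is the size of the `Γ_x`-orbit of `y`,
which is the number of neighbours of `x` lying over `e`. -/
theorem weightedAdj_toQ {K : Type*} [Field K] {i : ZMod 4} {x : Vertex K}
    (hx : Finite (MulAction.stabilizer (Gam K) x)) (hfin : (nbrs i x).Finite)
    (f : QVertex K → ℂ) :
    weightedAdj i f (toQ x) = ∑ᶠ y ∈ nbrs i x, f (toQ y) := by
  classical
  set s := hfin.toFinset with hs
  have hs' : nbrs i x = (s : Set (Vertex K)) := hfin.coe_toFinset.symm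
  have himg : outEdges i (toQ x) = (s.image (toQPair x) : Finset (QPair K)) := by
    rw [outEdges_eq_image, hs', Finset.coe_image]
  rw [weightedAdj, himg, hs', finsum_mem_coe_finset, finsum_mem_coe_finset,
    ← Finset.sum_fiberwise_of_maps_to (g := toQPair x) (t := s.image (toQPair x))
      fun y hy => Finset.mem_image_of_mem _ hy]
  refine Finset.sum_congr rfl fun e he => ?_
  obtain ⟨y, hy, rfl⟩ := Finset.mem_image.1 he
  have hfib : ((s.filter fun y' => toQPair x y' = toQPair x y : Finset (Vertex K)) :
      Set (Vertex K)) = MulAction.orbit (MulAction.stabilizer (Gam K) x) y := by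
    ext y'
    rw [Finset.coe_filter, Set.mem_ofPred_eq, toQPair_eq_iff]
    constructor
    · rintro ⟨-, γ, h1, h2⟩
      exact ⟨⟨γ, h1⟩, h2⟩
    · rintro ⟨⟨γ, h1⟩, h2⟩
      refine ⟨?_, γ, h1, h2⟩
      have hy' : y ∈ nbrs i x := by rw [hs']; exact hy
      have := smul_mem_nbrs γ hy'
      rw [h1, show γ • y = y' from h2, hs'] at this
      exact this
  have hcard : (s.filter fun y' => toQPair x y' = toQPair x y).card =
      Nat.card (MulAction.orbit (MulAction.stabilizer (Gam K) x) y) := by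
    rw [← hfib, Nat.card_coe_set_eq, Set.ncard_coe_finset]
  have hw : weight (toQPair x y) / weight (toQ x) =
      ((s.filter fun y' => toQPair x y' = toQPair x y).card : ℝ) := by
    change ((Nat.card (MulAction.stabilizer (Gam K) (x, y)) : ℝ))⁻¹ /
      ((Nat.card (MulAction.stabilizer (Gam K) x) : ℝ))⁻¹ = _
    have h1 : Nat.card (MulAction.stabilizer (Gam K) x) =
        Nat.card (MulAction.orbit (MulAction.stabilizer (Gam K) x) y) *
          Nat.card (MulAction.stabilizer (Gam K) (x, y)) := card_orbit_stabilizer x y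
    -- Finiteness of `Γ_x` matters here: `Nat.card` of an infinite group would be `0`.
    have h2 : Nat.card (MulAction.stabilizer (Gam K) (x, y)) ≠ 0 := by
      intro h0
      rw [h0, mul_zero] at h1
      exact Nat.card_pos.ne' h1
    rw [hcard, h1]
    push_cast
    field_simp
  rw [hw, Finset.sum_congr rfl (g := fun _ => f (target (toQPair x y))), Finset.sum_const,
    nsmul_eq_mul, Complex.ofReal_natCast]
  intro y' hy'
  rw [← (Finset.mem_filter.1 hy').2]
  rfl

/-- The eigenvalue operators in terms of dominant weights. -/
theorem weightedAdj_tDiag {K : Type*} [Field K] [Fintype K] {μ : Fin 4 → ℤ} (hμ : Antitone μ)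
    {i : ℕ} (h0 : 0 < i) (h4 : i < 4) (f : QVertex K → ℂ) :
    weightedAdj (i : ZMod 4) f (toQ (vertexOf (tDiag K μ))) =
      ∑ S ∈ Finset.powersetCard i Finset.univ, (Fintype.card K : ℂ) ^ Fintype.card (CellIndex S) *
        f (toQ (vertexOf (tDiag K (μ + ind S)))) := by
  obtain ⟨hfin, hsum⟩ := sum_nbrs (tDiag K μ) h0 h4 fun y => f (toQ y)
  rw [weightedAdj_toQ (finite_stabilizer hμ) hfin, hsum]
  refine Finset.sum_congr rfl fun S _ => ?_
  simp only [toQ_cell hμ S, Finset.sum_const, Finset.card_univ, Fintype.card_fun, nsmul_eq_mul,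
    Nat.cast_pow]

theorem swapInv_toQ {K : Type*} [Field K] {α : Type*} (f : QVertex K → α) :
    SwapInv fun μ => f (toQ (vertexOf (tDiag K μ))) := by
  intro μ k _
  dsimp only
  rw [toQ_tDiag_comp_perm]

theorem toQ_tDiag_add_const {K : Type*} [Field K] (μ : Fin 4 → ℤ) (k : ℤ) :
    toQ (vertexOf (tDiag K (μ + fun _ => k))) = toQ (vertexOf (tDiag K μ)) := by
  rw [tDiag_add, vertexOf_mul_tDiag_const]

/-! ### Uniqueness -/

/-- The fundamental weights. -/
def fund (i : ℕ) : Finset (Fin 4) := Finset.univ.filter fun j => (j : ℕ) < i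

theorem card_fund {i : ℕ} (h : i < 4) : (fund i).card = i := by
  revert h
  revert i
  decide

theorem rho_ind_lt_fund {i : ℕ} (h : i < 4) (S : Finset (Fin 4)) (hS : S.card = i)
    (hne : S ≠ fund i) : rho (ind S) < rho (ind (fund i)) := by
  revert hne hS S
  revert i
  decide

theorem rho_ind_fund_pos {i : ℕ} (h0 : 0 < i) (h : i < 4) : 0 < rho (ind (fund i)) := by
  revert h0
  revert h
  revert i
  decide

theorem rho_nonneg {μ : Fin 4 → ℤ} (hμ : Antitone μ) : 0 ≤ rho μ := by
  have h1 := hμ (show (0 : Fin 4) ≤ 1 by decide)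
  have h2 := hμ (show (1 : Fin 4) ≤ 2 by decide)
  have h3 := hμ (show (2 : Fin 4) ≤ 3 by decide)
  unfold rho
  omega

theorem exists_eq_add_fund {μ : Fin 4 → ℤ} (hμ : Antitone μ) (hne : μ 3 < μ 0) :
    ∃ (i : ℕ) (ν : Fin 4 → ℤ), 0 < i ∧ i < 4 ∧ Antitone ν ∧ μ = ν + ind (fund i) := by
  have h1 := hμ (show (0 : Fin 4) ≤ 1 by decide)
  have h2 := hμ (show (1 : Fin 4) ≤ 2 by decide)
  have h3 := hμ (show (2 : Fin 4) ≤ 3 by decide)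
  obtain ⟨k, hk⟩ : ∃ k : Fin 3, μ k.succ < μ k.castSucc := by
    by_contra! h
    have e1 : μ 0 ≤ μ 1 := h 0
    have e2 : μ 1 ≤ μ 2 := h 1
    have e3 : μ 2 ≤ μ 3 := h 2
    omega
  refine ⟨k + 1, μ - ind (fund (k + 1)), by omega, by omega, ?_, by simp⟩
  rw [Fin.antitone_iff_succ_le] at hμ ⊢
  intro j
  have hj := hμ j
  simp only [Pi.sub_apply, ind, fund, Finset.mem_filter, Finset.mem_univ, true_and, Fin.val_succ,
    Fin.val_castSucc]
  by_cases hjk : j = k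
  · subst hjk
    simp
    omega
  · have : (j : ℕ) ≠ k := fun h => hjk (Fin.ext h)
    split_ifs <;> omega

/-- Induction on `rho`. Write `μ = ν + ind (fund i)`. In the equation at `ν`, each term sorts either
to `μ` itself or to an antitone weight of smaller `rho`, where `φ` vanishes already. -/
theorem eq_zero_of_eigen {q : ℂ} {Q : ℕ} (hq : q = Q) (lam : ℕ → ℂ) {φ : (Fin 4 → ℤ) → ℂ}
    (hswap : SwapInv φ) (hshift : ∀ μ (k : ℤ), φ (μ + fun _ => k) = φ μ)
    (heig : ∀ μ, Antitone μ → ∀ i, 0 < i → i < 4 →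
      ∑ S ∈ Finset.powersetCard i Finset.univ, q ^ Fintype.card (CellIndex S) * φ (μ + ind S) =
        lam i * φ μ)
    (h0 : φ 0 = 0) {μ : Fin 4 → ℤ} (hμ : Antitone μ) : φ μ = 0 := by
  obtain ⟨N, hN⟩ : ∃ N : ℕ, rho μ < N := ⟨(rho μ + 1).toNat, by omega⟩
  induction N generalizing μ with
  | zero =>
    have := rho_nonneg hμ
    omega
  | succ N ih =>
    rcases lt_or_ge (μ 3) (μ 0) with hlt | hge
    · obtain ⟨i, ν, hi0, hi4, hν, rfl⟩ := exists_eq_add_fund hμ hlt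
      have hpos := rho_ind_fund_pos hi0 hi4
      rw [rho_add] at hN
      push_cast at hN
      have hE := heig ν hν i hi0 hi4
      rw [ih hν (by omega), mul_zero] at hE
      -- Coefficients are recorded as natural numbers so that they cannot cancel: that of `φ μ` is
      -- `1` from `S = fund i` plus a natural number.
      have hterm : ∀ S ∈ Finset.powersetCard i (Finset.univ : Finset (Fin 4)),
          ∃ n : ℕ, q ^ Fintype.card (CellIndex S) * φ (ν + ind S) =
            n * φ (ν + ind (fund i)) := by
        intro S hS
        obtain ⟨S', hc, ha, hφ⟩ := exists_antitone_of_swapInv hν S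
        rw [hφ φ hswap]
        by_cases hS' : S' = fund i
        · exact ⟨Q ^ Fintype.card (CellIndex S), by rw [hS', hq]; push_cast; rfl⟩
        · refine ⟨0, ?_⟩
          have hlt' := rho_ind_lt_fund hi4 S' (hc.trans (Finset.mem_powersetCard.1 hS).2) hS'
          rw [ih ha (by rw [rho_add]; omega)]
          simp
      choose! n hn using hterm
      have hmem : fund i ∈ Finset.powersetCard i (Finset.univ : Finset (Fin 4)) :=
        Finset.mem_powersetCard.2 ⟨Finset.subset_univ _, card_fund hi4⟩
      have hq0 : q ^ Fintype.card (CellIndex (fund i)) = 1 := by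
        have : Fintype.card (CellIndex (fund i)) = 0 := by
          clear * - hi4
          revert i
          decide
        rw [this, pow_zero]
      rw [← Finset.add_sum_erase _ _ hmem, hq0, one_mul,
        Finset.sum_congr rfl fun S hS => hn S (Finset.mem_of_mem_erase hS), ← Finset.sum_mul,
        ← one_add_mul] at hE
      refine (mul_eq_zero.1 hE).resolve_left ?_
      rw [← Nat.cast_sum, add_comm]
      exact Nat.cast_add_one_ne_zero _
    · have h1 := hμ (show (0 : Fin 4) ≤ 1 by decide)
      have h2 := hμ (show (1 : Fin 4) ≤ 2 by decide)
      have h3 := hμ (show (2 : Fin 4) ≤ 3 by decide)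
      have : μ = 0 + fun _ => μ 0 := by
        ext j
        rw [Pi.add_apply, Pi.zero_apply, zero_add]
        fin_cases j <;> simp <;> omega
      rw [this, hshift, h0]

/-! ### The eigenfunction -/

/-- The function on the quotient whose value at the orbit of a dominant weight is the
Hall–Littlewood sum. -/
def eigenFun (K : Type*) [Field K] (q sq : ℂ) (z : Fin 4 → ℂ) (u : QVertex K) : ℂ :=
  hallSum q sq z (exists_antitone_eq_toQ u).choose

/-- The chosen weight differs from `μ` by a constant, which `hallSum` ignores when the product of
the `z i` is `1`. -/
theorem eigenFun_tDiag {K : Type*} [Field K] {q sq : ℂ} {z : Fin 4 → ℂ} (hz : ∀ i, z i ≠ 0)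
    (h : sigma 4 z = 1) {μ : Fin 4 → ℤ} (hμ : Antitone μ) :
    eigenFun K q sq z (toQ (vertexOf (tDiag K μ))) = hallSum q sq z μ := by
  obtain ⟨h1, h2⟩ := (exists_antitone_eq_toQ (toQ (vertexOf (tDiag K μ)))).choose_spec
  obtain ⟨k, hk⟩ := toQ_tDiag_eq hμ h1 h2
  rw [eigenFun, hk, hallSum_shift hz h]

/-- The eigenvalue of the operator that raises the colour by `i`. -/
def eigenvalue (sq : ℂ) (z : Fin 4 → ℂ) (i : ℕ) : ℂ := sq ^ ((i : ℤ) * (4 - i)) * sigma i z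

theorem weightedAdj_eigenFun {K : Type*} [Field K] [Fintype K] {q sq : ℂ}
    (hq : q = (Fintype.card K : ℂ)) (hsq : sq ^ 2 = q) (h0 : sq ≠ 0) {z : Fin 4 → ℂ}
    (hinj : Function.Injective z) (hz : ∀ i, z i ≠ 0) (h : sigma 4 z = 1) {i : ℕ} (hi : 0 < i)
    (hi4 : i < 4) :
    weightedAdj (i : ZMod 4) (eigenFun K q sq z) = eigenvalue sq z i • eigenFun K q sq z := by
  ext u
  obtain ⟨μ, hμ, rfl⟩ := exists_antitone_eq_toQ u
  rw [weightedAdj_tDiag hμ hi hi4, Pi.smul_apply, eigenFun_tDiag hz h hμ, smul_eq_mul, eigenvalue,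
    ← hallSum_pieri hsq h0 hz, ← hq]
  refine Finset.sum_congr rfl fun S _ => ?_
  -- `μ + ind S` need not be antitone, but both the orbit function and `hallSum` take the same
  -- values there as at the sorted weight `μ + ind S'`.
  obtain ⟨S', -, ha, hφ⟩ := exists_antitone_of_swapInv hμ S
  rw [hφ _ (hallSum_swapInv hsq h0 hinj hz), ← eigenFun_tDiag (K := K) hz h ha,
    hφ (fun ν => eigenFun K q sq z (toQ (vertexOf (tDiag K ν))))
      (swapInv_toQ (K := K) (eigenFun K q sq z))]

theorem eq_of_eigen {K : Type*} [Field K] [Fintype K] (lam : ℕ → ℂ) {f g : QVertex K → ℂ}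
    (hf : ∀ i : ℕ, 0 < i → i < 4 → weightedAdj (i : ZMod 4) f = lam i • f)
    (hg : ∀ i : ℕ, 0 < i → i < 4 → weightedAdj (i : ZMod 4) g = lam i • g)
    (h0 : f (toQ (vertexOf (tDiag K 0))) = g (toQ (vertexOf (tDiag K 0)))) : f = g := by
  ext u
  obtain ⟨μ, hμ, rfl⟩ := exists_antitone_eq_toQ u
  refine sub_eq_zero.1 (eq_zero_of_eigen (Q := Fintype.card K) rfl lam
    (φ := fun μ => f (toQ (vertexOf (tDiag K μ))) - g (toQ (vertexOf (tDiag K μ))))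
    ?_ ?_ ?_ (sub_eq_zero.2 h0) hμ)
  · exact swapInv_toQ fun u => f u - g u
  · intro μ k
    rw [toQ_tDiag_add_const]
  · intro μ hμ i hi hi4
    have e1 := congrFun (hf i hi hi4) (toQ (vertexOf (tDiag K μ)))
    have e2 := congrFun (hg i hi hi4) (toQ (vertexOf (tDiag K μ)))
    rw [weightedAdj_tDiag hμ hi hi4, Pi.smul_apply, smul_eq_mul] at e1 e2
    simp only [mul_sub, Finset.sum_sub_distrib, e1, e2]

theorem weightedAdj_smul {K : Type*} [Field K] [Fintype K] {i : ℕ} (hi : 0 < i) (hi4 : i < 4)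
    (a : ℂ) (f : QVertex K → ℂ) :
    weightedAdj (i : ZMod 4) (a • f) = a • weightedAdj (i : ZMod 4) f := by
  ext u
  obtain ⟨μ, hμ, rfl⟩ := exists_antitone_eq_toQ u
  simp only [weightedAdj_tDiag hμ hi hi4, Pi.smul_apply, smul_eq_mul, Finset.mul_sum]
  exact Finset.sum_congr rfl fun S _ => by ring

theorem ne_zero_of_sigma_four {z : Fin 4 → ℂ} (h : sigma 4 z = 1) (i : Fin 4) : z i ≠ 0 := by
  intro hi
  have : Finset.powersetCard 4 (Finset.univ : Finset (Fin 4)) = {Finset.univ} := by decide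
  rw [sigma_eq_sum, this, Finset.sum_singleton, Finset.prod_eq_zero (Finset.mem_univ i) hi] at h
  exact zero_ne_one h

theorem constD_natCast_ne_zero (n : ℕ) : constD (n : ℂ) ≠ 0 := by
  have : constD (n : ℂ) = (((n + 1) * (n ^ 2 + n + 1) * (n ^ 3 + n ^ 2 + n + 1) : ℕ) : ℂ) := by
    simp [constD]
  rw [this, Nat.cast_ne_zero]
  positivity

theorem antitone_vec {l m n : ℕ} (h1 : n ≤ m) (h2 : m ≤ l) :
    Antitone ![(l : ℤ), m, n, 0] := by
  rw [Fin.antitone_iff_succ_le]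
  intro i
  fin_cases i
  · exact Int.ofNat_le.2 h2
  · exact Int.ofNat_le.2 h1
  · exact Int.natCast_nonneg n

theorem hallSum_vec (q sq : ℂ) (z : Fin 4 → ℂ) (l m n : ℕ) :
    hallSum q sq z ![(l : ℤ), m, n, 0] = ∑ τ : Equiv.Perm (Fin 4),
      constC q z (τ 0) (τ 1) (τ 2) (τ 3) * sq ^ (3 * (l : ℤ) + (m : ℤ) - (n : ℤ)) *
        z (τ 0) ^ l * z (τ 1) ^ m * z (τ 2) ^ n := by
  refine Finset.sum_congr rfl fun τ _ => ?_
  have hr : rho ![(l : ℤ), m, n, 0] = 3 * (l : ℤ) + (m : ℤ) - (n : ℤ) := by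
    simp [rho]
  rw [hr, Fin.prod_univ_four]
  simp [mul_assoc]

theorem satisfiesEigenEqs_iff {K : Type*} [Field K] {sq q : ℂ} (hsq : sq ^ 2 = q)
    (z : Fin 4 → ℂ) (f : QVertex K → ℂ) :
    SatisfiesEigenEqs (q * sq * sigma 1 z) (q ^ 2 * sigma 2 z) (q * sq * sigma 3 z) f ↔
      ∀ i : ℕ, 0 < i → i < 4 → weightedAdj (i : ZMod 4) f = eigenvalue sq z i • f := by
  have e1 : eigenvalue sq z 1 = q * sq * sigma 1 z := by
    have : ((1 : ℕ) : ℤ) * (4 - (1 : ℕ)) = (3 : ℕ) := by norm_num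
    rw [eigenvalue, this, zpow_natCast, ← hsq]
    ring
  have e2 : eigenvalue sq z 2 = q ^ 2 * sigma 2 z := by
    have : ((2 : ℕ) : ℤ) * (4 - (2 : ℕ)) = (4 : ℕ) := by norm_num
    rw [eigenvalue, this, zpow_natCast, ← hsq]
    ring
  have e3 : eigenvalue sq z 3 = q * sq * sigma 3 z := by
    have : ((3 : ℕ) : ℤ) * (4 - (3 : ℕ)) = (3 : ℕ) := by norm_num
    rw [eigenvalue, this, zpow_natCast, ← hsq]
    ring
  rw [SatisfiesEigenEqs, ← e1, ← e2, ← e3]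
  constructor
  · rintro ⟨h1, h2, h3⟩ i hi hi4
    interval_cases i
    · exact_mod_cast h1
    · exact_mod_cast h2
    · exact_mod_cast h3
  · intro h
    exact ⟨by exact_mod_cast h 1 (by norm_num) (by norm_num),
      by exact_mod_cast h 2 (by norm_num) (by norm_num),
      by exact_mod_cast h 3 (by norm_num) (by norm_num)⟩

end BuildingPGL4

end

/-- Here `q = |K|` and `√q` is the positive square root. The entries `z₁, …, z₄` are `z 0, …, z 3`. -/
theorem theorem5p1 (K : Type*) [Field K] [Fintype K]
    (q sq : ℂ) (hq : q = (Fintype.card K : ℂ)) (hsq : sq = ((Real.sqrt (Fintype.card K) : ℝ) : ℂ))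
    (z : Fin 4 → ℂ) (hz : Function.Injective z)
    (lam₁ lam₂ lam₃ : ℂ)
    (h₁ : lam₁ = q * sq * BuildingPGL4.sigma 1 z)
    (h₂ : lam₂ = q ^ 2 * BuildingPGL4.sigma 2 z)
    (h₃ : lam₃ = q * sq * BuildingPGL4.sigma 3 z)
    (h₄ : BuildingPGL4.sigma 4 z = 1) :
    ∃ fz : BuildingPGL4.QVertex K → ℂ,
      BuildingPGL4.SatisfiesEigenEqs lam₁ lam₂ lam₃ fz ∧
      fz (BuildingPGL4.v K 0 0 0) = 1 ∧
      (∀ l m n : ℕ, n ≤ m → m ≤ l →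
        fz (BuildingPGL4.v K l m n) =
          ∑ τ : Equiv.Perm (Fin 4),
            BuildingPGL4.constC q z (τ 0) (τ 1) (τ 2) (τ 3) *
              sq ^ (3 * (l : ℤ) + (m : ℤ) - (n : ℤ)) *
              z (τ 0) ^ l * z (τ 1) ^ m * z (τ 2) ^ n) ∧
      (∀ f : BuildingPGL4.QVertex K → ℂ,
        BuildingPGL4.SatisfiesEigenEqs lam₁ lam₂ lam₃ f →
          f = f (BuildingPGL4.v K 0 0 0) • fz) := by
  have hsq2 : sq ^ 2 = q := by
    rw [hsq, hq, ← Complex.ofReal_pow, Real.sq_sqrt (Nat.cast_nonneg _), Complex.ofReal_natCast]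
  have hq0 : q ≠ 0 := by
    rw [hq, Nat.cast_ne_zero]
    exact Fintype.card_ne_zero
  have hsq0 : sq ≠ 0 := by
    rintro rfl
    exact hq0 (by rw [← hsq2]; ring)
  have hz0 := BuildingPGL4.ne_zero_of_sigma_four h₄
  have hv : ∀ l m n : ℕ, n ≤ m → m ≤ l →
      BuildingPGL4.eigenFun K q sq z (BuildingPGL4.v K l m n) =
        BuildingPGL4.hallSum q sq z ![(l : ℤ), m, n, 0] := fun l m n h1 h2 => by
    rw [BuildingPGL4.v, BuildingPGL4.diagMat_eq,
      BuildingPGL4.eigenFun_tDiag hz0 h₄ (BuildingPGL4.antitone_vec h1 h2)]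
  have hzero : ![((0 : ℕ) : ℤ), (0 : ℕ), (0 : ℕ), 0] = 0 := by
    ext i
    fin_cases i <;> rfl
  have hone : BuildingPGL4.eigenFun K q sq z (BuildingPGL4.v K 0 0 0) = 1 := by
    rw [hv 0 0 0 le_rfl le_rfl, hzero]
    exact BuildingPGL4.hallSum_zero (hq ▸ BuildingPGL4.constD_natCast_ne_zero _) hz
  have heig : ∀ i : ℕ, 0 < i → i < 4 →
      BuildingPGL4.weightedAdj (i : ZMod 4) (BuildingPGL4.eigenFun K q sq z) =
        BuildingPGL4.eigenvalue sq z i • BuildingPGL4.eigenFun K q sq z :=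
    fun i hi hi4 => BuildingPGL4.weightedAdj_eigenFun hq hsq2 hsq0 hz hz0 h₄ hi hi4
  subst h₁ h₂ h₃
  refine ⟨BuildingPGL4.eigenFun K q sq z,
    (BuildingPGL4.satisfiesEigenEqs_iff hsq2 z _).2 heig, hone, fun l m n h1 h2 => ?_,
    fun f hf => ?_⟩
  · rw [hv l m n h1 h2, BuildingPGL4.hallSum_vec]
  · rw [BuildingPGL4.satisfiesEigenEqs_iff hsq2] at hf
    -- Compare `f` with the multiple of the eigenfunction that has the same value at the base
    -- vertex.
    refine BuildingPGL4.eq_of_eigen (BuildingPGL4.eigenvalue sq z) hf (fun i hi hi4 => ?_) ?_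
    · rw [BuildingPGL4.weightedAdj_smul hi hi4, heig i hi hi4, smul_comm]
    · have h0 : BuildingPGL4.v K 0 0 0 =
          BuildingPGL4.toQ (BuildingPGL4.vertexOf (BuildingPGL4.tDiag K 0)) := by
        rw [BuildingPGL4.v, BuildingPGL4.diagMat_eq, hzero]
      rw [← h0, Pi.smul_apply, hone, smul_eq_mul, mul_one]
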